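/- Let $U$ be a connected Riemann surface, $x$ a nonconstant meromorphic function on $U$, and $K$ a functional differential field on $(U,x)$: a field of meromorphic functions on $U$ that contains all complex constants and is closed under the derivation $f\mapsto f'=df/dx$. An extension of $K$ is a functional differential field $L$ on $(V,\pi^*x)$, where $\pi:V\to U$ is a nonconstant analytic map from a connected Riemann surface $V$, such that $L\supset\pi^*K\cong K$. For a set $M\subset L$ let $K\langle M\rangle$ be the smallest differential subfield of $L$ containing $K$ and $M$. An element $y\in L$ is representable by generalized quadratures over $K$ if there is a chain of differential fields $K=F_0\subset F_1\subset\dots\subset F_m$ in $L$ with $y\in F_m$ and $F_{i+1}=F_i\langle y_i\rangle$, where for each $i$ the element $y_i$ is algebraic over $F_i$, or $y_i'\in F_i$, or $y_i'=ay_i$ with $a\in F_i$. Let $n\ge 1$, let $a_1,\dots,a_n\in K$, and consider the equation $$y^{(n)}+a_1y^{(n-1)}+\dots+a_ny=0.\qquad (*)$$ A monic homogeneous linear differential equation of order $n\ge 0$ over $K$ is called solvable by generalized quadratures over $K$ if some extension $L$ of $K$ contains $n$ solutions that are linearly independent over $\mathbb C$ and every solution in $L$ is representable by generalized quadratures over $K$.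 Theorem. The equation $(*)$ is solvable by generalized quadratures over $K$ if and only if, in some extension of $K$, it has a solution $y_1$ such that: 1) $y_1=\exp z$, where $z$ is a meromorphic function whose derivative $z'=f$ is algebraic over $K$; 2) the linear differential equation of order $n-1$ over the differential field $K\langle y_1\rangle$ that is obtained from $(*)$ by the reduction of order using $y_1$, i.e. the equation $$u^{(n-1)}+c_1u^{(n-2)}+\dots+c_{n-1}u=0,\qquad c_i=\frac1{y_1}\sum_{m=0}^{i}\binom{n-m}{n-i}a_m\,y_1^{(i-m)},\quad a_0=1,$$ satisfied by $u=(y/y_1)'$ for all solutions $y$ of $(*)$, is solvable by generalized quadratures over $K\langle y_1\rangle$. -/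

import Mathlib

open scoped Manifold ContDiff Differential

universe u

/-! ### Riemann surfaces and meromorphic functions -/

/-- A connected Riemann surface: a connected Hausdorff space with a holomorphic atlas
modelled on `ℂ`. -/
structure RiemannSurface where
  carrier : Type u
  [topology : TopologicalSpace carrier]
  [hausdorff : T2Space carrier]
  [connected : ConnectedSpace carrier]
  [charted : ChartedSpace ℂ carrier]
  [manifold : IsManifold 𝓘(ℂ) ω carrier]

namespace RiemannSurface

instance : CoeSort RiemannSurface.{u} (Type u) := ⟨carrier⟩

attribute [instance] topology hausdorff connected charted manifold

variable (U : RiemannSurface.{u})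

/-- `f` is meromorphic on `U`: it is so in a local coordinate around each point. The values of
`f` on a closed discrete set (in particular at the poles) are irrelevant. -/
def IsMeromorphic (f : U → ℂ) : Prop :=
  ∀ p : U, MeromorphicAt (f ∘ (chartAt ℂ p).symm) (chartAt ℂ p p)

/-- The function `df / dx` on `U`, computed at each point in a local coordinate. -/
noncomputable def derivWrt (x f : U → ℂ) : U → ℂ := fun p =>
  deriv (f ∘ (chartAt ℂ p).symm) (chartAt ℂ p p) /
    deriv (x ∘ (chartAt ℂ p).symm) (chartAt ℂ p p)

/-- Functions on `U` up to equality off a closed discrete set; two meromorphic functions are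
the same if and only if they have the same class here. -/
abbrev FunctionClass : Type u := Filter.Germ (Filter.codiscrete U) ℂ

end RiemannSurface

/-! ### Functional differential fields -/

/-- A functional differential field: a connected Riemann surface `U`, a nonconstant meromorphic
function `x` on it, and a differential field containing the complex constants that is
identified, by `toFun`, with a field of meromorphic functions on `U`, the derivation being
`f ↦ df / dx`. -/
structure FunctionalDiffField where
  surface : RiemannSurface.{u}
  x : surface → ℂ
  x_meromorphic : surface.IsMeromorphic x
  x_nonconstant : ¬ ∃ c : ℂ, (x : surface.FunctionClass) = ((fun _ => c : surface → ℂ))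
  carrier : Type u
  [field : Field carrier]
  [differential : Differential carrier]
  [algebra : Algebra ℂ carrier]
  /-- The inclusion into functions on the surface; injective, as `carrier` is a field. -/
  toFun : carrier →+* surface.FunctionClass
  meromorphic : ∀ k : carrier, ∃ f : surface → ℂ, surface.IsMeromorphic f ∧ toFun k = f
  toFun_const : ∀ c : ℂ, toFun (algebraMap ℂ carrier c) = ((fun _ => c : surface → ℂ))
  toFun_deriv : ∀ (k : carrier) (f : surface → ℂ),
    toFun k = f → toFun k′ = (surface.derivWrt x f : surface → ℂ)

namespace FunctionalDiffField

instance : CoeSort FunctionalDiffField.{u} (Type u) := ⟨carrier⟩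

attribute [instance] field differential algebra

/-- An extension of a functional differential field `K` on `(U, x)`: a functional differential
field `L` on `(V, π^* x)`, where `π : V → U` is a nonconstant analytic map of connected Riemann
surfaces, that contains `π^* K`. -/
structure Extension (K : FunctionalDiffField.{u}) where
  top : FunctionalDiffField.{u}
  proj : top.surface → K.surface
  proj_analytic : ContMDiff 𝓘(ℂ) 𝓘(ℂ) ω proj
  proj_nonconstant : ¬ ∃ p, ∀ v, proj v = p
  x_eq : (top.x : top.surface.FunctionClass) = (K.x ∘ proj : top.surface → ℂ)
  pullback : K →+* top
  toFun_pullback : ∀ (k : K) (f : K.surface → ℂ),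
    K.toFun k = f → top.toFun (pullback k) = (f ∘ proj : top.surface → ℂ)

namespace Extension

variable {K : FunctionalDiffField.{u}}

instance : CoeOut (Extension K) FunctionalDiffField.{u} := ⟨top⟩

noncomputable instance instAlgebraTop (L : Extension K) : Algebra K L.top := L.pullback.toAlgebra

/-- The adjunction `K⟨M⟩`: the smallest differential subfield of `L` that contains `K` and the
set `M`. -/
noncomputable def diffAdjoin (L : Extension K) (M : Set L.top) : IntermediateField K L.top :=
  sInf {E | (∀ z ∈ E, z′ ∈ E) ∧ M ⊆ E}

/-- `L.QuadratureTower E`: there is a chain `K = F₀ ⊆ F₁ ⊆ ⋯ ⊆ Fₘ = E` of differential subfields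
of `L` in which each `Fᵢ₊₁` is `Fᵢ⟨y⟩` with `y` algebraic over `Fᵢ`, or an integral over `Fᵢ`, or
an exponential of integral over `Fᵢ`. -/
inductive QuadratureTower (L : Extension K) : IntermediateField K L.top → Prop
  | base : QuadratureTower L ⊥
  | algebraic (E : IntermediateField K L.top) (y : L.top) :
      QuadratureTower L E → IsAlgebraic E y →
      QuadratureTower L (L.diffAdjoin (insert y (E : Set L.top)))
  | integral (E : IntermediateField K L.top) (y : L.top) :
      QuadratureTower L E → y′ ∈ E →
      QuadratureTower L (L.diffAdjoin (insert y (E : Set L.top)))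
  | expIntegral (E : IntermediateField K L.top) (y a : L.top) :
      QuadratureTower L E → a ∈ E → y′ = a * y →
      QuadratureTower L (L.diffAdjoin (insert y (E : Set L.top)))

/-- `y ∈ L` is representable by generalized quadratures over `K`. -/
def IsRepresentable (L : Extension K) (y : L.top) : Prop :=
  ∃ E : IntermediateField K L.top, L.QuadratureTower E ∧ y ∈ E

/-- `y = exp z` for a meromorphic function `z` whose derivative is algebraic over `K`. -/
def IsExpOfAlgebraicIntegral (L : Extension K) (y : L.top) : Prop :=
  ∃ (z : L.top.surface → ℂ) (f : L.top),
    L.top.surface.IsMeromorphic z ∧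
    L.top.toFun y = (fun p => Complex.exp (z p) : L.top.surface → ℂ) ∧
    L.top.toFun f = (L.top.surface.derivWrt L.top.x z : L.top.surface → ℂ) ∧
    IsAlgebraic K f

end Extension

/-! ### Linear differential equations -/

/-- The `k`-th derivative. -/
def iterDeriv {F : Type u} [Field F] [Differential F] (k : ℕ) (y : F) : F :=
  (fun z : F => z′)^[k] y

/-- `y` satisfies `y⁽ⁿ⁾ + a₁ y⁽ⁿ⁻¹⁾ + ⋯ + aₙ y = 0`. Only the values `a 1, …, a n` are used. -/
def IsSolution {F : Type u} [Field F] [Differential F] (n : ℕ) (a : ℕ → F) (y : F) : Prop :=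
  iterDeriv n y + ∑ i ∈ Finset.Icc 1 n, a i * iterDeriv (n - i) y = 0

/-- The coefficients `c₁, …, cₙ₋₁` of the equation `u⁽ⁿ⁻¹⁾ + c₁ u⁽ⁿ⁻²⁾ + ⋯ + cₙ₋₁ u = 0` for
`u = (y / y₁)′` that is obtained from `y⁽ⁿ⁾ + a₁ y⁽ⁿ⁻¹⁾ + ⋯ + aₙ y = 0` by substituting
`y = y₁ w`, expanding by the Leibniz rule, dividing by `y₁` and putting `u = w′`. -/
def reducedCoeff {F : Type u} [Field F] [Differential F] (n : ℕ) (a : ℕ → F) (y₁ : F) (i : ℕ) :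
    F :=
  ((n.choose i : F) * iterDeriv i y₁ +
    ∑ m ∈ Finset.Icc 1 i, ((n - m).choose (n - i) : F) * a m * iterDeriv (i - m) y₁) / y₁

/-- The equation `y⁽ⁿ⁾ + a₁ y⁽ⁿ⁻¹⁾ + ⋯ + aₙ y = 0` is solvable by generalized quadratures over
`K`: some extension of `K` contains `n` solutions that are linearly independent over `ℂ` (hence
the whole solution space), and all solutions in it are representable by generalized quadratures
over `K`. -/
def SolvableByQuadratures (K : FunctionalDiffField.{u}) (n : ℕ) (a : ℕ → K) : Prop :=
  ∃ L : Extension K,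
    (∃ v : Fin n → L.top, LinearIndependent ℂ v ∧
      ∀ j, IsSolution n (fun i => algebraMap K L.top (a i)) (v j)) ∧
    ∀ y : L.top, IsSolution n (fun i => algebraMap K L.top (a i)) y → L.IsRepresentable y

end FunctionalDiffField

/-!
The logarithmic derivatives of the solutions of a linear equation of order `n` are the solutions of
its generalized Riccati equation of order `n - 1`. If the equation is solvable by generalized
quadratures, the Riccati equation has a solution in a tower of quadratures over `K`, and then one
algebraic over `K`: a step `A(t) ⊇ A` of the tower, with `A` algebraically closed, is removed by
means of a place over `t = ∞` with residue field `A`. The derivation does not lower orders at this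
place, so a Riccati solution is integral there and its residue is a Riccati solution in `A`. Over an
extension containing all solutions of the linear equation, an algebraic Riccati solution is the
logarithmic derivative of one of them, which is an exponential after shrinking the surface, and
reduction of order by it stays inside the field of representable elements.

Conversely, integrals of solutions of the reduced equation, multiplied by `y₁`, together with `y₁`
form a fundamental system of the original equation.
-/

namespace FunctionalDiffField

/-! ### Linear differential operators and reduction of order -/

section LinearOperators

variable {F : Type*} [Field F] [Differential F]

@[simp]
lemma iterDeriv_zero (y : F) : iterDeriv 0 y = y := rfl

lemma iterDeriv_succ (k : ℕ) (y : F) : iterDeriv (k + 1) y = (iterDeriv k y)′ :=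
  Function.iterate_succ_apply' _ _ _

lemma iterDeriv_succ' (k : ℕ) (y : F) : iterDeriv (k + 1) y = iterDeriv k y′ :=
  Function.iterate_succ_apply _ _ _

lemma iterDeriv_add (k : ℕ) (y z : F) : iterDeriv k (y + z) = iterDeriv k y + iterDeriv k z := by
  induction k with
  | zero => rfl
  | succ k ih => simp only [iterDeriv_succ, ih, map_add]

lemma iterDeriv_const_mul {c : F} (hc : c′ = 0) (k : ℕ) (y : F) :
    iterDeriv k (c * y) = c * iterDeriv k y := by
  induction k with
  | zero => rfl
  | succ k ih => simp [iterDeriv_succ, ih, hc]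

lemma iterDeriv_mul_eq_sum_antidiagonal (k : ℕ) (y z : F) :
    iterDeriv k (y * z) = ∑ ij ∈ Finset.HasAntidiagonal.antidiagonal k,
      (k.choose ij.1 : F) * (iterDeriv ij.2 y * iterDeriv ij.1 z) := by
  induction k with
  | zero => simp
  | succ k ih =>
    rw [Finset.sum_antidiagonal_choose_succ_mul (fun i j => iterDeriv j y * iterDeriv i z),
      iterDeriv_succ, ih, map_sum, ← Finset.sum_add_distrib]
    refine Finset.sum_congr rfl fun ij hij => ?_
    rw [Nat.choose_symm_of_eq_add (Finset.HasAntidiagonal.mem_antidiagonal.1 hij).symm]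
    simp only [Derivation.leibniz, smul_eq_mul, iterDeriv_succ, Derivation.map_natCast]
    ring

-- The terms with `j > k` vanish; allowing them lets all derivatives share one summation range.
lemma iterDeriv_mul {k N : ℕ} (hk : k ≤ N) (y z : F) :
    iterDeriv k (y * z) =
      ∑ j ∈ Finset.range (N + 1), (k.choose j : F) * iterDeriv (k - j) y * iterDeriv j z := by
  rw [iterDeriv_mul_eq_sum_antidiagonal, Finset.Nat.sum_antidiagonal_eq_sum_range_succ
    (fun i j => (k.choose i : F) * (iterDeriv j y * iterDeriv i z))]
  simp only [mul_assoc]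
  refine Finset.sum_subset (Finset.range_subset_range.2 (by omega)) fun j _ hj => ?_
  rw [Nat.choose_eq_zero_of_lt (by simpa using hj), Nat.cast_zero, zero_mul]

/-- The linear differential operator `y ↦ y⁽ⁿ⁾ + a₁ y⁽ⁿ⁻¹⁾ + ⋯ + aₙ y`, whose zeros are the
solutions in the sense of `IsSolution`. -/
def linOp (n : ℕ) (a : ℕ → F) (y : F) : F :=
  iterDeriv n y + ∑ i ∈ Finset.Icc 1 n, a i * iterDeriv (n - i) y

lemma isSolution_iff {n : ℕ} {a : ℕ → F} {y : F} : IsSolution n a y ↔ linOp n a y = 0 := Iff.rfl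

lemma linOp_add (n : ℕ) (a : ℕ → F) (y z : F) :
    linOp n a (y + z) = linOp n a y + linOp n a z := by
  simp only [linOp, iterDeriv_add, mul_add, Finset.sum_add_distrib]
  ring

lemma linOp_const_mul (n : ℕ) (a : ℕ → F) {c : F} (hc : c′ = 0) (y : F) :
    linOp n a (c * y) = c * linOp n a y := by
  simp only [linOp, iterDeriv_const_mul hc, mul_add, Finset.mul_sum, mul_left_comm c]

lemma linOp_eq_sum_range (n : ℕ) (a : ℕ → F) (y : F) :
    linOp n a y =
      ∑ m ∈ Finset.range (n + 1), Function.update a 0 1 m * iterDeriv (n - m) y := by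
  rw [Finset.sum_range_succ', Function.update_self, one_mul, Nat.sub_zero, add_comm, linOp,
    Finset.range_eq_Ico, Finset.sum_Ico_add'
      (fun m => Function.update a 0 1 m * iterDeriv (n - m) y) 0 n 1]
  refine congrArg _ (Finset.sum_congr rfl fun m hm => ?_)
  rw [Function.update_of_ne (by simp at hm; omega)]

lemma linOp_succ (n : ℕ) (a : ℕ → F) (y : F) :
    linOp (n + 1) a y = linOp n a y′ + a (n + 1) * y := by
  rw [linOp, Finset.sum_Icc_succ_top (by omega), Nat.sub_self, iterDeriv_zero, ← add_assoc,
    iterDeriv_succ', linOp]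
  congr 2
  refine Finset.sum_congr rfl fun i hi => ?_
  rw [Nat.succ_sub (Finset.mem_Icc.1 hi).2, iterDeriv_succ']

lemma reducedCoeff_zero {n : ℕ} (a : ℕ → F) {y₁ : F} (hy : y₁ ≠ 0) :
    reducedCoeff n a y₁ 0 = 1 := by
  simp [reducedCoeff, hy]

lemma mul_reducedCoeff {n k : ℕ} (hk : k ≤ n) (a : ℕ → F) {y₁ : F} (hy : y₁ ≠ 0) :
    y₁ * reducedCoeff n a y₁ (n - k) = ∑ m ∈ Finset.range (n + 1),
      Function.update a 0 1 m * ((n - m).choose k * iterDeriv (n - m - k) y₁) := by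
  have hvanish : ∑ m ∈ Finset.range (n - k + 1),
        Function.update a 0 1 m * ((n - m).choose k * iterDeriv (n - m - k) y₁) = _ :=
    Finset.sum_subset (Finset.range_subset_range.2 (by omega : n - k + 1 ≤ n + 1))
      fun m hmn hm => by
        rw [Nat.choose_eq_zero_of_lt (by simp at hmn hm; omega), Nat.cast_zero, zero_mul, mul_zero]
  rw [← hvanish, reducedCoeff, mul_div_cancel₀ _ hy, Finset.sum_range_succ', Function.update_self,
    one_mul, Nat.sub_zero, Nat.choose_symm hk, add_comm, Finset.range_eq_Ico, Finset.sum_Ico_add'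
      (fun m => Function.update a 0 1 m * ((n - m).choose k * iterDeriv (n - m - k) y₁))
      0 (n - k) 1]
  refine congrArg (· + _) (Finset.sum_congr rfl fun m hm => ?_)
  rw [Function.update_of_ne (by simp at hm; omega), Nat.sub_sub_self hk, Nat.sub_right_comm]
  ring

lemma linOp_mul (n : ℕ) (a : ℕ → F) {y₁ : F} (hy : y₁ ≠ 0) (w : F) :
    linOp n a (y₁ * w) = y₁ * linOp n (reducedCoeff n a y₁) w := by
  calc linOp n a (y₁ * w)
      = ∑ m ∈ Finset.range (n + 1), ∑ k ∈ Finset.range (n + 1), Function.update a 0 1 m *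
          (((n - m).choose k : F) * iterDeriv (n - m - k) y₁ * iterDeriv k w) := by
        simp only [linOp_eq_sum_range, iterDeriv_mul (Nat.sub_le n _), Finset.mul_sum]
    _ = ∑ k ∈ Finset.range (n + 1), y₁ * (reducedCoeff n a y₁ (n - k) * iterDeriv k w) := by
        rw [Finset.sum_comm]
        refine Finset.sum_congr rfl fun k hk => ?_
        simp only [← mul_assoc, mul_reducedCoeff (Finset.mem_range_succ_iff.1 hk) a hy,
          Finset.sum_mul]
    _ = y₁ * linOp n (reducedCoeff n a y₁) w := by
        rw [linOp_eq_sum_range, Function.update_eq_self_iff.2 (reducedCoeff_zero a hy).symm,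
          ← Finset.sum_range_reflect, Finset.mul_sum]
        refine Finset.sum_congr rfl fun k hk => ?_
        rw [Nat.add_sub_cancel, Nat.sub_sub_self (Finset.mem_range_succ_iff.1 hk)]

lemma IsSolution.mul_iff {n : ℕ} {a : ℕ → F} {y₁ : F} (hy : y₁ ≠ 0)
    (h₁ : IsSolution (n + 1) a y₁) (w : F) :
    IsSolution (n + 1) a (y₁ * w) ↔ IsSolution n (reducedCoeff (n + 1) a y₁) w′ := by
  have hlast : reducedCoeff (n + 1) a y₁ (n + 1) = 0 := by
    have h : y₁ * linOp (n + 1) (reducedCoeff (n + 1) a y₁) 1 = 0 := by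
      rwa [← linOp_mul _ a hy, mul_one]
    have hzero : linOp n (reducedCoeff (n + 1) a y₁) 0 = 0 := by
      simpa using linOp_const_mul n (reducedCoeff (n + 1) a y₁) (c := 0) (map_zero _) 0
    simpa [linOp_succ, hzero, hy] using h
  rw [isSolution_iff, linOp_mul _ a hy, linOp_succ, hlast, zero_mul, add_zero,
    mul_eq_zero_iff_left hy, isSolution_iff]

variable {G : Type*} [Field G] [Differential G] [Algebra F G] [DifferentialAlgebra F G]

lemma algebraMap_iterDeriv (k : ℕ) (y : F) :
    algebraMap F G (iterDeriv k y) = iterDeriv k (algebraMap F G y) := by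
  induction k with
  | zero => rfl
  | succ k ih => rw [iterDeriv_succ, iterDeriv_succ, ← deriv_algebraMap, ih]

lemma isSolution_algebraMap_iff {n : ℕ} {a : ℕ → F} {y : F} :
    IsSolution n (fun i => algebraMap F G (a i)) (algebraMap F G y) ↔ IsSolution n a y := by
  simp only [IsSolution, ← algebraMap_iterDeriv, ← map_mul, ← map_sum, ← map_add,
    map_eq_zero]

lemma algebraMap_reducedCoeff (n : ℕ) (a : ℕ → F) (y : F) (i : ℕ) :
    algebraMap F G (reducedCoeff n a y i) =
      reducedCoeff n (fun i => algebraMap F G (a i)) (algebraMap F G y) i := by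
  simp [reducedCoeff, algebraMap_iterDeriv]

end LinearOperators

/-! ### Solution spaces and fundamental systems -/

section SolutionSpace

/-- The image of `C` is the field of constants of the differential field `F`. -/
class IsConstantField (C F : Type*) [Field C] [Field F] [Differential F] [Algebra C F] : Prop
    extends Differential.ContainConstants C F where
  deriv_algebraMap_const : ∀ c : C, (algebraMap C F c)′ = 0

variable {C F : Type*} [Field C] [Field F] [Differential F] [Algebra C F]

variable (C) in
/-- The `C`-linear space of solutions of a linear differential equation. -/
def solutionSpace [IsConstantField C F] (n : ℕ) (a : ℕ → F) : Submodule C F where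
  carrier := {y | IsSolution n a y}
  add_mem' {y z} hy hz := by
    rw [Set.mem_ofPred_eq, isSolution_iff] at *
    rw [linOp_add, hy, hz, add_zero]
  zero_mem' := by
    simpa [isSolution_iff] using linOp_const_mul n a (c := 0) (map_zero _) 0
  smul_mem' c y hy := by
    rw [Set.mem_ofPred_eq, isSolution_iff] at *
    rw [Algebra.smul_def, linOp_const_mul n a (IsConstantField.deriv_algebraMap_const c), hy,
      mul_zero]

variable (C) in
/-- A fundamental system of solutions: as many solutions, linearly independent over `C`, as the
order of the equation. -/
structure IsFundamentalSystem (n : ℕ) (a : ℕ → F) (v : Fin n → F) : Prop where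
  linearIndependent : LinearIndependent C v
  isSolution : ∀ j, IsSolution n a (v j)

lemma IsFundamentalSystem.map_algebraMap {G : Type*} [Field G] [Differential G] [Algebra F G]
    [DifferentialAlgebra F G] [Algebra C G] [IsScalarTower C F G] {n : ℕ} {a : ℕ → F}
    {v : Fin n → F} (hv : IsFundamentalSystem C n a v) :
    IsFundamentalSystem C n (fun i => algebraMap F G (a i)) (fun j => algebraMap F G (v j)) where
  linearIndependent := hv.linearIndependent.map_injOn (IsScalarTower.toAlgHom C F G).toLinearMap
    (FaithfulSMul.algebraMap_injective F G).injOn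
  isSolution j := isSolution_algebraMap_iff.2 (hv.isSolution j)

/-- The vector `(y, y′, …, y⁽ⁿ⁻¹⁾)` of initial data of a solution of an equation of order `n`. -/
def jet (n : ℕ) (y : F) : Fin n → F := fun k => iterDeriv k y

lemma IsSolution.iterDeriv_eq {n : ℕ} {a : ℕ → F} {y : F} (h : IsSolution n a y) :
    iterDeriv n y = -∑ i ∈ Finset.Icc 1 n, a i * iterDeriv (n - i) y :=
  eq_neg_of_add_eq_zero_left h

section JetCoefficients

variable {n m : ℕ} {a : ℕ → F} {v : Fin m → F} {q : ℕ → F} {l : Fin m → F}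

lemma eq_sum_iterDeriv_of_forall_lt (hv : ∀ j, IsSolution n a (v j))
    (hqn : q n + ∑ i ∈ Finset.Icc 1 n, a i * q (n - i) = 0)
    (hl : ∀ k < n, q k = ∑ j, l j * iterDeriv k (v j)) :
    q n = ∑ j, l j * iterDeriv n (v j) := by
  rw [eq_neg_of_add_eq_zero_left hqn]
  simp only [(hv _).iterDeriv_eq, mul_neg, Finset.sum_neg_distrib, Finset.mul_sum, neg_inj]
  rw [Finset.sum_comm]
  refine Finset.sum_congr rfl fun i hi => ?_
  rw [hl (n - i) (by simp at hi; omega), Finset.mul_sum]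
  exact Finset.sum_congr rfl fun _ _ => mul_left_comm _ _ _

-- Variation of constants: `(q 0, …, q (n - 1))` solves the companion system twisted by `g`.
lemma deriv_eq_mul_of_eq_sum_iterDeriv {g : F} (hv : ∀ j, IsSolution n a (v j))
    (hind : LinearIndependent F fun j => jet n (v j)) (hq : ∀ k, (q k)′ = q (k + 1) + g * q k)
    (hqn : q n + ∑ i ∈ Finset.Icc 1 n, a i * q (n - i) = 0)
    (hl : ∀ k < n, q k = ∑ j, l j * iterDeriv k (v j)) (j : Fin m) :
    (l j)′ = g * l j := by
  have hl' : ∀ k ≤ n, q k = ∑ j, l j * iterDeriv k (v j) := by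
    intro k hk
    rcases hk.lt_or_eq with hlt | rfl
    · exact hl k hlt
    · exact eq_sum_iterDeriv_of_forall_lt hv hqn hl
  have hsum : ∑ j, ((l j)′ - g * l j) • jet n (v j) = 0 := by
    funext k
    have hqk := hq k
    rw [hl' k k.2.le, hl' (k + 1) k.2, map_sum, Finset.mul_sum, ← Finset.sum_add_distrib] at hqk
    rw [Finset.sum_apply, Pi.zero_apply, ← sub_eq_zero.2 hqk, ← Finset.sum_sub_distrib]
    refine Finset.sum_congr rfl fun j _ => ?_
    simp only [jet, Pi.smul_apply, smul_eq_mul, Derivation.leibniz, iterDeriv_succ]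
    ring
  exact sub_eq_zero.1 (Fintype.linearIndependent_iff.1 hind _ hsum j)

end JetCoefficients

variable [IsConstantField C F] {n : ℕ} {a : ℕ → F}

lemma linearIndependent_jet {m : ℕ} {v : Fin m → F} (hv : ∀ j, IsSolution n a (v j))
    (hind : LinearIndependent C v) : LinearIndependent F fun j => jet n (v j) := by
  induction m with
  | zero => exact linearIndependent_empty_type
  | succ m ih =>
    rw [linearIndependent_finSucc] at hind ⊢
    have htail := ih (v := Fin.tail v) (fun j => hv j.succ) hind.1
    refine ⟨htail, fun hmem => hind.2 ?_⟩
    obtain ⟨l, hl⟩ := (Submodule.mem_span_range_iff_exists_fun F).1 hmem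
    have hl' : ∀ k < n, iterDeriv k (v 0) = ∑ j, l j * iterDeriv k (v (Fin.succ j)) :=
      fun k hk => by simpa [jet, Fin.tail] using (congrFun hl ⟨k, hk⟩).symm
    have hconst := deriv_eq_mul_of_eq_sum_iterDeriv (q := fun k => iterDeriv k (v 0)) (g := 0)
      (fun j => hv j.succ) htail (fun k => by simp [iterDeriv_succ]) (hv 0) hl'
    choose c hc using fun j =>
      mem_range_of_deriv_eq_zero C (x := l j) (by simpa using hconst j)
    have hv0 : v 0 = ∑ j, l j * v (Fin.succ j) := by
      rcases Nat.eq_zero_or_pos n with rfl | hn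
      · have hv_zero : ∀ j, v j = 0 := fun j => by simpa [IsSolution] using hv j
        simp [hv_zero]
      · exact hl' 0 hn
    rw [hv0]
    refine Submodule.sum_mem _ fun j _ => ?_
    rw [← hc, ← Algebra.smul_def]
    exact Submodule.smul_mem _ _ (Submodule.subset_span ⟨j, rfl⟩)

namespace IsFundamentalSystem

variable {v : Fin n → F}

lemma span_eq_solutionSpace (hv : IsFundamentalSystem C n a v) :
    Submodule.span C (Set.range v) = solutionSpace C n a := by
  refine le_antisymm (Submodule.span_le.2 (Set.range_subset_iff.2 hv.isSolution)) fun y hy => ?_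
  by_contra hmem
  have hcons : LinearIndependent C (Fin.cons y v : Fin (n + 1) → F) :=
    linearIndependent_finCons.2 ⟨hv.linearIndependent, hmem⟩
  have hjet := linearIndependent_jet (v := Fin.cons y v) (Fin.cases hy hv.isSolution) hcons
  simpa using hjet.fintype_card_le_finrank

lemma finrank_solutionSpace (hv : IsFundamentalSystem C n a v) :
    Module.finrank C (solutionSpace C n a) = n := by
  rw [← hv.span_eq_solutionSpace, finrank_span_eq_card hv.linearIndependent, Fintype.card_fin]

lemma finiteDimensional_solutionSpace (hv : IsFundamentalSystem C n a v) :
    FiniteDimensional C (solutionSpace C n a) :=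
  hv.span_eq_solutionSpace ▸ FiniteDimensional.span_of_finite C (Set.finite_range v)

omit [IsConstantField C F] in
lemma mem_range_algebraMap {G : Type*} [Field G] [Differential G] [Algebra F G]
    [DifferentialAlgebra F G] [Algebra C G] [IsScalarTower C F G] [IsConstantField C G]
    (hv : IsFundamentalSystem C n a v) {y : G}
    (hy : IsSolution n (fun i => algebraMap F G (a i)) y) : y ∈ Set.range (algebraMap F G) := by
  have hmem : y ∈ Submodule.span C (Set.range fun j => algebraMap F G (v j)) := by
    rw [hv.map_algebraMap.span_eq_solutionSpace]
    exact hy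
  refine Submodule.span_le (p := LinearMap.range (IsScalarTower.toAlgHom C F G).toLinearMap).2 ?_
    hmem
  exact Set.range_subset_iff.2 fun j => ⟨v j, rfl⟩

end IsFundamentalSystem

variable (C) in
/-- The `C`-linear map `y ↦ (y / y₁)′`, which carries solutions of an equation to solutions of the
equation reduced by the solution `y₁`. -/
def reductionMap (y₁ : F) : F →ₗ[C] F where
  toFun y := Differential.deriv (y / y₁)
  map_add' y z := by rw [add_div, map_add]
  map_smul' c y := by
    rw [Algebra.smul_def, mul_div_assoc, Derivation.leibniz, IsConstantField.deriv_algebraMap_const,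
      smul_zero, add_zero, smul_eq_mul, RingHom.id_apply, Algebra.smul_def]

lemma ker_reductionMap_le {y₁ : F} (hy : y₁ ≠ 0) :
    LinearMap.ker (reductionMap C y₁) ≤ Submodule.span C {y₁} := by
  intro y h
  obtain ⟨c, hc⟩ := mem_range_of_deriv_eq_zero C (x := y / y₁) h
  exact Submodule.mem_span_singleton.2 ⟨c, by rw [Algebra.smul_def, hc, div_mul_cancel₀ _ hy]⟩

lemma IsFundamentalSystem.exists_reduced {v : Fin (n + 1) → F}
    (hv : IsFundamentalSystem C (n + 1) a v) {y₁ : F} (hy : y₁ ≠ 0)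
    (h₁ : IsSolution (n + 1) a y₁) :
    ∃ w : Fin n → F, IsFundamentalSystem C n (reducedCoeff (n + 1) a y₁) w ∧
      ∀ j, ∃ y, IsSolution (n + 1) a y ∧ w j = (y / y₁)′ := by
  have := hv.finiteDimensional_solutionSpace
  let T := (reductionMap C y₁).domRestrict (solutionSpace C (n + 1) a)
  have hker : Module.finrank C (LinearMap.ker T) ≤ 1 := by
    let ι : LinearMap.ker T →ₗ[C] Submodule.span C {y₁} :=
      ((solutionSpace C (n + 1) a).subtype.comp (LinearMap.ker T).subtype).codRestrict _
        fun y => ker_reductionMap_le hy y.2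
    have hι : Function.Injective ι := fun y z h =>
      Subtype.ext (Subtype.ext (congrArg (fun s : Submodule.span C {y₁} => (s : F)) h))
    exact (LinearMap.finrank_le_finrank_of_injective hι).trans (finrank_span_singleton hy).le
  have hrange : n ≤ Module.finrank C (LinearMap.range T) := by
    have := LinearMap.finrank_range_add_finrank_ker T
    rw [hv.finrank_solutionSpace] at this
    omega
  obtain ⟨w, hw⟩ := exists_linearIndependent_of_le_finrank hrange
  choose y hy' using fun j => (w j).2
  refine ⟨fun j => w j, ⟨hw.map' (Submodule.subtype _) (Submodule.ker_subtype _), fun j => ?_⟩,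
    fun j => ⟨y j, (y j).2, (hy' j).symm⟩⟩
  rw [← hy' j]
  refine (h₁.mul_iff hy (y j / y₁)).1 ?_
  rw [mul_div_cancel₀ _ hy]
  exact (y j).2

lemma linearIndependent_cons_mul {m : ℕ} {y : F} (hy : y ≠ 0) {I : Fin m → F}
    (hind : LinearIndependent C fun j => (I j)′) :
    LinearIndependent C (Fin.cons y fun j => y * I j : Fin (m + 1) → F) := by
  rw [Fintype.linearIndependent_iff] at hind ⊢
  intro g hg
  rw [Fin.sum_univ_succ] at hg
  simp only [Fin.cons_zero, Fin.cons_succ, Algebra.smul_def] at hg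
  have hsum : algebraMap C F (g 0) + ∑ j : Fin m, algebraMap C F (g j.succ) * I j = 0 := by
    refine mul_left_cancel₀ hy ?_
    rw [mul_zero, ← hg, mul_add, Finset.mul_sum, mul_comm y]
    exact congrArg _ (Finset.sum_congr rfl fun _ _ => by ring)
  have hsucc : ∀ j, g (Fin.succ j) = 0 := by
    refine hind (fun j => g j.succ) ?_
    simpa [IsConstantField.deriv_algebraMap_const, Algebra.smul_def] using
      congrArg Differential.deriv hsum
  exact Fin.cases (by simpa [hsucc] using hsum) hsucc

lemma IsFundamentalSystem.of_reduced {y₁ : F} (hy : y₁ ≠ 0) (h₁ : IsSolution (n + 1) a y₁)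
    {I : Fin n → F}
    (hI : IsFundamentalSystem C n (reducedCoeff (n + 1) a y₁) fun j => (I j)′) :
    IsFundamentalSystem C (n + 1) a (Fin.cons y₁ fun j => y₁ * I j) where
  linearIndependent := linearIndependent_cons_mul hy hI.linearIndependent
  isSolution := Fin.cases h₁ fun j => (h₁.mul_iff hy (I j)).2 (hI.isSolution j)

end SolutionSpace

/-! ### The generalized Riccati equation -/

section Riccati

variable {F : Type*} [Field F] [Differential F]

/-- The differential polynomials of `u` such that `y⁽ᵏ⁾ = riccati u k * y` whenever `y′ = u * y`. -/
def riccati (u : F) : ℕ → F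
  | 0 => 1
  | k + 1 => (riccati u k)′ + u * riccati u k

/-- The generalized Riccati equation, satisfied by `u = y′ / y` for the nonzero solutions `y` of the
linear equation with coefficients `a`. -/
def IsRiccatiSolution (n : ℕ) (a : ℕ → F) (u : F) : Prop :=
  riccati u n + ∑ i ∈ Finset.Icc 1 n, a i * riccati u (n - i) = 0

lemma iterDeriv_eq_riccati_mul {y u : F} (h : y′ = u * y) (k : ℕ) :
    iterDeriv k y = riccati u k * y := by
  induction k with
  | zero => simp [riccati]
  | succ k ih =>
    simp only [iterDeriv_succ, ih, Derivation.leibniz, smul_eq_mul, h, riccati]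
    ring

lemma isSolution_iff_isRiccatiSolution {n : ℕ} {a : ℕ → F} {y u : F} (hy : y ≠ 0)
    (h : y′ = u * y) : IsSolution n a y ↔ IsRiccatiSolution n a u := by
  simp only [IsSolution, iterDeriv_eq_riccati_mul h, ← mul_assoc, ← Finset.sum_mul, ← add_mul]
  rw [mul_eq_zero_iff_right hy, IsRiccatiSolution]

section AlgebraMap

variable {G : Type*} [Field G] [Differential G] [Algebra F G] [DifferentialAlgebra F G]

lemma algebraMap_riccati (u : F) (k : ℕ) :
    algebraMap F G (riccati u k) = riccati (algebraMap F G u) k := by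
  induction k with
  | zero => simp [riccati]
  | succ k ih => simp [riccati, ← deriv_algebraMap, ih]

lemma isRiccatiSolution_algebraMap_iff {n : ℕ} {a : ℕ → F} {u : F} :
    IsRiccatiSolution n (fun i => algebraMap F G (a i)) (algebraMap F G u) ↔
      IsRiccatiSolution n a u := by
  simp only [IsRiccatiSolution, ← algebraMap_riccati, ← map_mul, ← map_sum, ← map_add,
    map_eq_zero]

end AlgebraMap

lemma IsRiccatiSolution.exists_isSolution {C : Type*} [Field C] [Algebra C F]
    [IsConstantField C F] {n : ℕ} {a : ℕ → F} {v : Fin (n + 1) → F}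
    (hv : IsFundamentalSystem C (n + 1) a v) {u : F} (hu : IsRiccatiSolution (n + 1) a u) :
    ∃ y, IsSolution (n + 1) a y ∧ y ≠ 0 ∧ y′ = u * y := by
  have hjet := linearIndependent_jet hv.isSolution hv.linearIndependent
  have hmem : (fun k : Fin (n + 1) => riccati u k) ∈
      Submodule.span F (Set.range fun j => jet (n + 1) (v j)) :=
    hjet.span_eq_top_of_card_eq_finrank' (by simp) ▸ Submodule.mem_top
  obtain ⟨l, hl⟩ := (Submodule.mem_span_range_iff_exists_fun F).1 hmem
  have hriccati : ∀ k < n + 1, riccati u k = ∑ j, l j * iterDeriv k (v j) := fun k hk => by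
    simpa [jet] using (congrFun hl ⟨k, hk⟩).symm
  have hderiv := deriv_eq_mul_of_eq_sum_iterDeriv (g := -u) hv.isSolution hjet
    (fun k => by simp [riccati]) hu hriccati
  obtain ⟨i, hi⟩ : ∃ i, l i ≠ 0 := by
    by_contra! hzero
    simpa [hzero, riccati] using hriccati 0 (Nat.succ_pos n)
  have hinv : ((l i)⁻¹)′ = u * (l i)⁻¹ := by
    rw [Derivation.leibniz_inv, hderiv, smul_eq_mul]
    field_simp
  exact ⟨(l i)⁻¹, (isSolution_iff_isRiccatiSolution (inv_ne_zero hi) hinv).2 hu,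
    inv_ne_zero hi, hinv⟩

lemma IsFundamentalSystem.exists_logDeriv_eq {C G : Type*} [Field C] [Algebra C F]
    [Field G] [Differential G] [Algebra F G] [DifferentialAlgebra F G]
    [Algebra C G] [IsScalarTower C F G] [IsConstantField C G] {n : ℕ} {a : ℕ → F}
    {v : Fin (n + 1) → F} (hv : IsFundamentalSystem C (n + 1) a v) {u : G}
    (hu : IsRiccatiSolution (n + 1) (fun i => algebraMap F G (a i)) u) :
    ∃ y, IsSolution (n + 1) a y ∧ y ≠ 0 ∧ algebraMap F G (y′ / y) = u := by
  obtain ⟨y', hy', hy'0, hyu⟩ := hu.exists_isSolution (hv.map_algebraMap (G := G))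
  obtain ⟨y, rfl⟩ := hv.mem_range_algebraMap hy'
  refine ⟨y, isSolution_algebraMap_iff.1 hy', (map_ne_zero _).1 hy'0, ?_⟩
  rw [map_div₀, ← deriv_algebraMap, hyu, mul_div_cancel_right₀ _ hy'0]

end Riccati

/-! ### Derivations and valuations -/

section CoefficientField

variable {A M Γ : Type*} [Field A] [Field M] [Algebra A M] [LinearOrderedCommGroupWithZero Γ]

variable (A) in
/-- `A` is a coefficient field of the valuation `v`: it lies in the valuation ring and maps onto
the residue field. -/
structure IsCoefficientField (v : Valuation M Γ) : Prop where
  algebraMap_le_one : ∀ a : A, v (algebraMap A M a) ≤ 1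
  exists_sub_lt_one : ∀ x, v x ≤ 1 → ∃ a : A, v (x - algebraMap A M a) < 1

namespace IsCoefficientField

variable {v : Valuation M Γ} (hA : IsCoefficientField A v)

include hA

lemma algebraMap_eq_one {a : A} (ha : a ≠ 0) : v (algebraMap A M a) = 1 := by
  refine le_antisymm (hA.algebraMap_le_one a) ?_
  have hinv := hA.algebraMap_le_one a⁻¹
  rw [map_inv₀, map_inv₀] at hinv
  exact (inv_le_one₀ (zero_lt_iff.2 (by simpa using ha))).1 hinv

lemma intCast_le_one (k : ℤ) : v (k : M) ≤ 1 := by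
  simpa using hA.algebraMap_le_one (k : A)

lemma intCast_eq_one [CharZero A] {k : ℤ} (hk : k ≠ 0) : v (k : M) = 1 := by
  simpa using hA.algebraMap_eq_one (Int.cast_ne_zero.2 hk)

end IsCoefficientField

end CoefficientField

lemma logDeriv_zpow {F : Type*} [Field F] [Differential F] (x : F) (k : ℤ) :
    Differential.logDeriv (x ^ k) = k * Differential.logDeriv x := by
  rcases eq_or_ne x 0 with rfl | hx
  · rcases eq_or_ne k 0 with rfl | hk <;> simp [zero_zpow, *]
  obtain ⟨n, rfl | rfl⟩ := k.eq_nat_or_neg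
  · simp [Differential.logDeriv_pow]
  · rw [zpow_neg, zpow_natCast, ← one_div, Differential.logDeriv_div _ _ one_ne_zero
      (pow_ne_zero n hx), Differential.logDeriv_one, Differential.logDeriv_pow]
    push_cast
    ring

section DiscreteValuation

open WithZero

variable {M : Type*} [Field M] {v : Valuation M (WithZero (Multiplicative ℤ))} {π : M}
  (hπ : v π = exp (-1))

include hπ

lemma ne_zero_of_valuation_eq_exp_neg_one : π ≠ 0 := by
  rintro rfl
  exact exp_ne_zero (hπ.symm.trans (map_zero v))

lemma valuation_lt_one_of_eq_exp_neg_one : v π < 1 := by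
  rw [hπ, ← exp_zero, exp_lt_exp]
  norm_num

lemma exists_eq_zpow_mul_valuation_eq_one {x : M} (hx : x ≠ 0) :
    ∃ (k : ℤ) (ε : M), v ε = 1 ∧ x = π ^ k * ε := by
  have hπ₀ := ne_zero_of_valuation_eq_exp_neg_one hπ
  refine ⟨-log (v x), π ^ log (v x) * x, ?_, ?_⟩
  · rw [map_mul, map_zpow₀, hπ, ← exp_zsmul, ← exp_log ((v.ne_zero_iff).2 hx), ← exp_add]
    simp
  · rw [← mul_assoc, ← zpow_add₀ hπ₀]
    simp

lemma exists_eq_mul_add_algebraMap {A : Type*} [Field A] [Algebra A M]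
    (hA : IsCoefficientField A v) {x : M} (hx : v x ≤ 1) :
    ∃ (z : M) (a : A), v z ≤ 1 ∧ x = π * z + algebraMap A M a := by
  obtain ⟨a, ha⟩ := hA.exists_sub_lt_one x hx
  have hπ₀ := ne_zero_of_valuation_eq_exp_neg_one hπ
  refine ⟨(x - algebraMap A M a) / π, a, ?_, by field_simp; ring⟩
  have hle : v (x - algebraMap A M a) ≤ v π := by
    rw [← lt_mul_exp_iff_le (by simpa using hπ₀), hπ, ← exp_add]
    simpa using ha
  rw [map_div₀]
  exact div_le_one_of_le₀ hle zero_le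

variable [Differential M]

variable {A : Type*} [Field A] [Algebra A M] [Differential A] [DifferentialAlgebra A M]
  (hA : IsCoefficientField A v) {N : WithZero (Multiplicative ℤ)}
  (hN : ∀ x, v x ≤ 1 → v x′ ≤ N)

include hA hN

lemma valuation_deriv_le_max_pow (k : ℕ) {x : M} (hx : v x ≤ 1) :
    v x′ ≤ max (max 1 (v π′)) (v π ^ k * N) := by
  induction k generalizing x with
  | zero => simpa using Or.inr (hN x hx)
  | succ k ih =>
    obtain ⟨z, a, hz, rfl⟩ := exists_eq_mul_add_algebraMap hπ hA hx
    have hπ₁ := (valuation_lt_one_of_eq_exp_neg_one hπ).le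
    have hderiv : (π * z + algebraMap A M a)′ = π * z′ + z * π′ + algebraMap A M a′ := by
      rw [map_add, Derivation.leibniz, smul_eq_mul, smul_eq_mul, deriv_algebraMap]
    rw [hderiv]
    refine v.map_add_le (v.map_add_le ?_ ?_) ?_
    · rw [map_mul]
      calc v π * v z′ ≤ v π * max (max 1 (v π′)) (v π ^ k * N) := by gcongr; exact ih hz
        _ = max (v π * max 1 (v π′)) (v π * (v π ^ k * N)) := mul_max _ _ _
        _ ≤ max (max 1 (v π′)) (v π ^ (k + 1) * N) := by
          rw [pow_succ', mul_assoc]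
          exact max_le_max_right _ (mul_le_of_le_one_left' hπ₁)
    · rw [map_mul]
      exact (mul_le_of_le_one_left' hz).trans (le_max_of_le_left (le_max_right _ _))
    · exact (hA.algebraMap_le_one _).trans (le_max_of_le_left (le_max_left _ _))

lemma valuation_deriv_le_max {x : M} (hx : v x ≤ 1) : v x′ ≤ max 1 (v π′) := by
  by_contra! hlt
  have hle (k : ℕ) : v x′ ≤ v π ^ k * N :=
    (le_max_iff.1 (valuation_deriv_le_max_pow hπ hA hN k hx)).resolve_left hlt.not_ge
  have hx' : 0 < v x′ := zero_lt_one.trans ((le_max_left _ _).trans_lt hlt)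
  have hN₀ : 0 < N := hx'.trans_le (hN x hx)
  obtain ⟨k, hk⟩ := exists_exp_neg_natCast_lt (div_ne_zero hx'.ne' hN₀.ne')
  rw [lt_div_iff₀ hN₀] at hk
  refine (hle k).not_gt ?_
  rwa [hπ, ← exp_nsmul, nsmul_eq_mul, mul_neg_one]

variable [CharZero A] {s : M} (hs₀ : s ≠ 0) (hs₁ : v s < 1) (hs : v s′ ≤ v s)

include hs₀ hs₁ hs

lemma valuation_logDeriv_uniformizer_le_one : v (Differential.logDeriv π) ≤ 1 := by
  have hπ₀ := ne_zero_of_valuation_eq_exp_neg_one hπ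
  obtain ⟨e, ε, hε, rfl⟩ := exists_eq_zpow_mul_valuation_eq_one hπ hs₀
  have he : e ≠ 0 := by
    rintro rfl
    simp [hε] at hs₁
  have hε₀ : ε ≠ 0 := (v.ne_zero_iff).1 (by simp [hε])
  have hvs : v (Differential.logDeriv (π ^ e * ε)) ≤ 1 := by
    rw [Differential.logDeriv, map_div₀]
    exact div_le_one_of_le₀ hs zero_le
  have hvε : v (Differential.logDeriv ε) ≤ max 1 (v (Differential.logDeriv π) * v π) := by
    rw [Differential.logDeriv, Differential.logDeriv, map_div₀, hε, div_one, ← map_mul,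
      div_mul_cancel₀ _ hπ₀]
    exact valuation_deriv_le_max hπ hA hN hε.le
  have hsub : e * Differential.logDeriv π =
      Differential.logDeriv (π ^ e * ε) - Differential.logDeriv ε := by
    rw [Differential.logDeriv_mul _ _ (zpow_ne_zero e hπ₀) hε₀, logDeriv_zpow, add_sub_cancel_right]
  have hle : v (Differential.logDeriv π) ≤ max 1 (v (Differential.logDeriv π) * v π) := by
    calc v (Differential.logDeriv π) = v (e * Differential.logDeriv π) := by
          rw [map_mul, hA.intCast_eq_one he, one_mul]
      _ ≤ max 1 (v (Differential.logDeriv π) * v π) := by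
        rw [hsub]
        exact v.map_sub_le (hvs.trans (le_max_left _ _)) hvε
  by_contra! hlt
  refine (le_max_iff.1 hle).elim hlt.not_ge (not_le.2 ?_)
  exact mul_lt_of_lt_one_right (zero_lt_one.trans hlt) (valuation_lt_one_of_eq_exp_neg_one hπ)

/-- Expanding `x` in powers of `π` with coefficients in `A` replaces the bound `N` by
`max 1 (v π′)`, and then `s`, a power of `π` up to a unit, gives `v π′ ≤ v π`. -/
lemma valuation_deriv_le (x : M) : v x′ ≤ v x := by
  have hπ₀ := ne_zero_of_valuation_eq_exp_neg_one hπ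
  have hπ' := valuation_logDeriv_uniformizer_le_one hπ hA hN hs₀ hs₁ hs
  rcases eq_or_ne x 0 with rfl | hx
  · simp
  suffices hlog : v (Differential.logDeriv x) ≤ 1 by
    rw [← div_mul_cancel₀ x′ hx, map_mul]
    exact mul_le_of_le_one_left' hlog
  obtain ⟨k, ε, hε, rfl⟩ := exists_eq_zpow_mul_valuation_eq_one hπ hx
  have hε₀ : ε ≠ 0 := (v.ne_zero_iff).1 (by simp [hε])
  have hπ₁ : v π′ ≤ 1 := by
    rw [← div_mul_cancel₀ π′ hπ₀, map_mul]
    exact mul_le_one' hπ' (valuation_lt_one_of_eq_exp_neg_one hπ).le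
  rw [Differential.logDeriv_mul _ _ (zpow_ne_zero k hπ₀) hε₀, logDeriv_zpow]
  refine v.map_add_le ?_ ?_
  · rw [map_mul]
    exact mul_le_one' (hA.intCast_le_one k) hπ'
  · rw [Differential.logDeriv, map_div₀, hε, div_one]
    exact (valuation_deriv_le_max hπ hA hN hε.le).trans (max_le le_rfl hπ₁)

end DiscreteValuation

section RiccatiValuation

variable {M Γ : Type*} [Field M] [Differential M] [LinearOrderedCommGroupWithZero Γ]
  {v : Valuation M Γ} (hderiv : ∀ x, v x′ ≤ v x)

include hderiv

lemma valuation_riccati {u : M} (hu : 1 < v u) (k : ℕ) : v (riccati u k) = v u ^ k := by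
  have hu₀ : 0 < v u := zero_lt_one.trans hu
  induction k with
  | zero => simp [riccati]
  | succ k ih =>
    have hlt : v (riccati u k)′ < v (u * riccati u k) := by
      rw [map_mul, ih]
      calc v (riccati u k)′ ≤ v u ^ k := (hderiv _).trans ih.le
        _ < v u * v u ^ k := lt_mul_of_one_lt_left (pow_pos hu₀ k) hu
    rw [riccati, Valuation.map_add_eq_of_lt_right v hlt, map_mul, ih, pow_succ']

lemma valuation_riccati_le_one {u : M} (hu : v u ≤ 1) (k : ℕ) : v (riccati u k) ≤ 1 := by
  induction k with
  | zero => simp [riccati]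
  | succ k ih =>
    refine v.map_add_le ((hderiv _).trans ih) ?_
    rw [map_mul]
    exact mul_le_one' hu ih

lemma valuation_riccati_sub_lt_one {u c : M} (hc : v c ≤ 1) (huc : v (u - c) < 1) (k : ℕ) :
    v (riccati u k - riccati c k) < 1 := by
  induction k with
  | zero => simp [riccati]
  | succ k ih =>
    have hu : v u ≤ 1 := by simpa using v.map_add_le huc.le hc
    have hsplit : riccati u (k + 1) - riccati c (k + 1) = (riccati u k - riccati c k)′ +
        (u * (riccati u k - riccati c k) + (u - c) * riccati c k) := by
      simp only [riccati, map_sub]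
      ring
    rw [hsplit]
    refine v.map_add_lt ((hderiv _).trans_lt ih) (v.map_add_lt ?_ ?_) <;> rw [map_mul]
    · exact mul_lt_one_of_nonneg_of_lt_one_right hu zero_le ih
    · exact mul_lt_one_of_lt_of_le huc (valuation_riccati_le_one hderiv hc k)

lemma IsRiccatiSolution.valuation_le_one {n : ℕ} {a : ℕ → M} (ha : ∀ i, v (a i) ≤ 1) {u : M}
    (hu : IsRiccatiSolution n a u) : v u ≤ 1 := by
  by_contra! hlt
  have hu₀ : 0 < v u := zero_lt_one.trans hlt
  have hsum : v (∑ i ∈ Finset.Icc 1 n, a i * riccati u (n - i)) < v u ^ n := by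
    refine v.map_sum_lt (pow_pos hu₀ n).ne' fun i hi => ?_
    have hi := Finset.mem_Icc.1 hi
    rw [map_mul, valuation_riccati hderiv hlt]
    calc v (a i) * v u ^ (n - i) ≤ v u ^ (n - i) := mul_le_of_le_one_left' (ha i)
      _ < v u ^ n := pow_lt_pow_right₀ hlt (by omega)
  refine hsum.ne ?_
  rw [← valuation_riccati hderiv hlt n, eq_neg_of_add_eq_zero_left hu, Valuation.map_neg]

lemma IsRiccatiSolution.exists_residue {A : Type*} [Field A] [Differential A] [Algebra A M]
    [DifferentialAlgebra A M] (hA : IsCoefficientField A v) {n : ℕ} {a : ℕ → A} {u : M}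
    (hu : IsRiccatiSolution n (fun i => algebraMap A M (a i)) u) :
    ∃ c : A, IsRiccatiSolution n a c := by
  obtain ⟨c, hc⟩ := hA.exists_sub_lt_one u
    (hu.valuation_le_one hderiv fun i => hA.algebraMap_le_one _)
  refine ⟨c, of_not_not fun hne => ?_⟩
  have hsub := valuation_riccati_sub_lt_one hderiv (hA.algebraMap_le_one c) hc
  have hone := hA.algebraMap_eq_one hne
  have hneg : algebraMap A M (riccati c n + ∑ i ∈ Finset.Icc 1 n, a i * riccati c (n - i)) =
      -((riccati u n - riccati (algebraMap A M c) n) + ∑ i ∈ Finset.Icc 1 n,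
        algebraMap A M (a i) * (riccati u (n - i) - riccati (algebraMap A M c) (n - i))) := by
    simp only [map_add, map_sum, map_mul, algebraMap_riccati, mul_sub, Finset.sum_sub_distrib]
    unfold IsRiccatiSolution at hu
    linear_combination hu
  rw [hneg, Valuation.map_neg] at hone
  refine hone.not_lt (v.map_add_lt (hsub n) (v.map_sum_lt one_ne_zero fun i _ => ?_))
  rw [map_mul]
  exact mul_lt_one_of_nonneg_of_lt_one_right (hA.algebraMap_le_one _) zero_le (hsub _)

end RiccatiValuation

section Place

open IsDedekindDomain Polynomial WithZero

lemma exists_sub_algebraMap_mem {A B : Type*} [Field A] [IsAlgClosed A] [CommRing B] [Algebra A B]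
    [Algebra A[X] B] [IsScalarTower A A[X] B] [Algebra.IsIntegral A[X] B] {Q : Ideal B} [Q.IsPrime]
    (hX : algebraMap A[X] B X ∈ Q) (b : B) : ∃ a : A, b - algebraMap A B a ∈ Q := by
  have hcomp : (algebraMap A (B ⧸ Q)).comp (evalRingHom 0) = algebraMap A[X] (B ⧸ Q) := by
    refine ringHom_ext (fun a => ?_) ?_
    · simpa using IsScalarTower.algebraMap_apply A A[X] (B ⧸ Q) a
    · simpa using (Ideal.Quotient.eq_zero_iff_mem.2 hX).symm
  have hint : Algebra.IsIntegral A (B ⧸ Q) := algebraMap_isIntegral_iff.1 <|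
    RingHom.IsIntegral.tower_top (evalRingHom 0) (algebraMap A (B ⧸ Q)) <|
      hcomp ▸ algebraMap_isIntegral_iff.2 inferInstance
  obtain ⟨a, ha⟩ := (IsAlgClosed.algebraMap_bijective_of_isIntegral
    (k := A) (K := B ⧸ Q)).2 (Ideal.Quotient.mk Q b)
  exact ⟨a, Ideal.Quotient.eq.1 ha.symm⟩

section HeightOneSpectrum

variable {B M : Type*} [CommRing B] [IsDedekindDomain B] [Field M] [Algebra B M]
  [IsFractionRing B M] (P : HeightOneSpectrum B)

lemma valuation_algebraMap_primeCompl (d : P.asIdeal.primeCompl) :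
    P.valuation M (algebraMap B M d) = 1 := by
  rw [P.valuation_of_algebraMap]
  exact (P.intValuation_eq_one_iff_mem_primeCompl _).2 d.2

lemma isCoefficientField_valuation {A : Type*} [Field A] [Algebra A B] [Algebra A M]
    [IsScalarTower A B M] (hP : ∀ b : B, ∃ a : A, b - algebraMap A B a ∈ P.asIdeal) :
    IsCoefficientField A (P.valuation M) where
  algebraMap_le_one a := by
    rw [IsScalarTower.algebraMap_apply A B M]
    exact P.valuation_le_one _
  exists_sub_lt_one x hx := by
    obtain ⟨b, d, hbd⟩ := P.exists_primeCompl_mul_eq_of_integer x hx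
    obtain ⟨β, hβ⟩ := hP b
    obtain ⟨δ, hδ⟩ := hP d
    have hδ₀ : δ ≠ 0 := by
      rintro rfl
      exact d.2 (by simpa using hδ)
    have hmem : b - algebraMap A B (β / δ) * d ∈ P.asIdeal := by
      have hβδ : algebraMap A B β = algebraMap A B (β / δ) * algebraMap A B δ := by
        rw [← map_mul, div_mul_cancel₀ _ hδ₀]
      have hsplit : b - algebraMap A B (β / δ) * d =
          b - algebraMap A B β - algebraMap A B (β / δ) * (d - algebraMap A B δ) := by
        rw [hβδ]
        ring
      rw [hsplit]
      exact sub_mem hβ (P.asIdeal.mul_mem_left _ hδ)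
    have hsub : (x - algebraMap A M (β / δ)) * algebraMap B M d =
        algebraMap B M (b - algebraMap A B (β / δ) * d) := by
      rw [map_sub, map_mul, ← IsScalarTower.algebraMap_apply A B M, sub_mul, hbd]
    have hval := congrArg (P.valuation M) hsub
    rw [map_mul, valuation_algebraMap_primeCompl, mul_one] at hval
    exact ⟨β / δ, hval.trans_lt <| (P.valuation_lt_one_iff_mem _).2 hmem⟩

lemma valuation_deriv_le_of_forall_algebraMap [Differential M] {N : WithZero (Multiplicative ℤ)}
    (hN : ∀ b : B, P.valuation M (algebraMap B M b)′ ≤ N) {x : M} (hx : P.valuation M x ≤ 1) :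
    P.valuation M x′ ≤ N := by
  obtain ⟨b, d, hbd⟩ := P.exists_primeCompl_mul_eq_of_integer x hx
  have hderiv : x′ * algebraMap B M d = (algebraMap B M b)′ - x * (algebraMap B M d)′ := by
    rw [← hbd, Derivation.leibniz, smul_eq_mul, smul_eq_mul]
    ring
  rw [← mul_one (P.valuation M _), ← valuation_algebraMap_primeCompl (M := M) P d, ← map_mul,
    hderiv]
  refine Valuation.map_sub_le _ (hN b) ?_
  rw [map_mul]
  exact mul_le_of_le_one_of_le hx (hN d)

end HeightOneSpectrum

lemma exists_forall_valuation_deriv_le {R B M Γ : Type*} [CommRing R] [CommRing B] [Field M]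
    [LinearOrderedCommGroupWithZero Γ] [Algebra R B] [Algebra R M] [Algebra B M]
    [IsScalarTower R B M] [Module.Finite R B] [Differential M] {v : Valuation M Γ}
    (hB : ∀ b : B, v (algebraMap B M b) ≤ 1) (hR : ∀ r : R, v (algebraMap R M r)′ ≤ 1) :
    ∃ N : Γ, ∀ b : B, v (algebraMap B M b)′ ≤ N := by
  obtain ⟨S, hS⟩ := Module.Finite.fg_top (R := R) (M := B)
  refine ⟨S.sup (fun b => v (algebraMap B M b)′) ⊔ 1, fun b => ?_⟩
  have hb : b ∈ Submodule.span R (S : Set B) := hS ▸ Submodule.mem_top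
  induction hb using Submodule.span_induction with
  | mem b hb =>
    exact (Finset.le_sup (f := fun b => v (algebraMap B M b)′) hb).trans le_sup_left
  | zero => simp
  | add b c _ _ hb hc =>
    rw [map_add, map_add]
    exact v.map_add_le hb hc
  | smul r b _ hb =>
    rw [Algebra.smul_def, map_mul, ← IsScalarTower.algebraMap_apply R B M, Derivation.leibniz,
      smul_eq_mul, smul_eq_mul]
    refine v.map_add_le ?_ ?_ <;> rw [map_mul]
    · refine mul_le_of_le_one_of_le ?_ hb
      rw [IsScalarTower.algebraMap_apply R B M]
      exact hB _
    · exact (mul_le_one' (hB b) (hR r)).trans le_sup_right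

lemma exists_heightOneSpectrum_algebraMap_mem {R : Type*} (B : Type*) [CommRing R] [CommRing B]
    [Algebra R B] [FaithfulSMul R B] [Algebra.IsIntegral R B] {r : R}
    (hr : (Ideal.span {r}).IsMaximal) (hr0 : r ≠ 0) :
    ∃ P : HeightOneSpectrum B, algebraMap R B r ∈ P.asIdeal := by
  obtain ⟨Q, hQ, hlies⟩ := Ideal.exists_maximal_ideal_liesOver_of_isIntegral (S := B)
    (Ideal.span {r})
  have hrQ : algebraMap R B r ∈ Q :=
    (Ideal.mem_of_liesOver Q (Ideal.span {r}) r).1 (Ideal.mem_span_singleton_self r)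
  refine ⟨⟨Q, hQ.isPrime, fun h => hr0 <| FaithfulSMul.algebraMap_injective R B ?_⟩, hrQ⟩
  rwa [h, Ideal.mem_bot, ← map_zero (algebraMap R B)] at hrQ

/-- A finite extension of `A(X)` has a place over `X = 0`; the divisibility `X ∣ X′` is what makes
the derivation preserve orders there. -/
lemma exists_valuation_isCoefficientField (A K₀ : Type*) {M : Type*} [Field A] [IsAlgClosed A]
    [CharZero A] [Field K₀] [Field M] [Differential A] [Differential M] [Algebra A M]
    [DifferentialAlgebra A M] [Algebra A[X] M] [IsScalarTower A A[X] M] [Algebra A[X] K₀]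
    [IsFractionRing A[X] K₀] [Algebra K₀ M] [IsScalarTower A[X] K₀ M] [FiniteDimensional K₀ M]
    {q : A[X]} (hq : (algebraMap A[X] M X)′ = algebraMap A[X] M (X * q)) :
    ∃ v : Valuation M (WithZero (Multiplicative ℤ)),
      IsCoefficientField A v ∧ ∀ x, v x′ ≤ v x := by
  have : CharZero K₀ := charZero_of_injective_algebraMap (IsFractionRing.injective A[X] K₀)
  let B := integralClosure A[X] M
  have : IsDedekindDomain B := integralClosure.isDedekindDomain A[X] K₀ M
  have : IsFractionRing B M := integralClosure.isFractionRing_of_finite_extension K₀ M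
  have : Module.Finite A[X] B := IsIntegralClosure.finite A[X] K₀ M B
  have : FaithfulSMul A[X] M := .trans A[X] K₀ M
  have : FaithfulSMul A[X] B := .tower_bot A[X] B M
  obtain ⟨P, hXP⟩ := exists_heightOneSpectrum_algebraMap_mem B
    (PrincipalIdealRing.isMaximal_of_irreducible (irreducible_X (R := A))) X_ne_zero
  have hA : IsCoefficientField A (P.valuation M) :=
    isCoefficientField_valuation P (exists_sub_algebraMap_mem hXP)
  have hpoly (r : A[X]) : P.valuation M (algebraMap A[X] M r) ≤ 1 := by
    rw [IsScalarTower.algebraMap_apply A[X] B M]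
    exact P.valuation_le_one _
  have haeval (r : A[X]) : algebraMap A[X] M r = aeval (algebraMap A[X] M X) r := by
    rw [aeval_algebraMap_apply, aeval_X_left_apply]
  have hderiv (r : A[X]) : P.valuation M (algebraMap A[X] M r)′ ≤ 1 := by
    rw [haeval, Differential.deriv_aeval_eq_implicitDeriv _ (X * q) (by rw [hq, haeval]), ← haeval]
    exact hpoly _
  obtain ⟨N, hN⟩ := exists_forall_valuation_deriv_le (B := B) P.valuation_le_one hderiv
  obtain ⟨π, hπ⟩ := P.valuation_exists_uniformizer M
  refine ⟨P.valuation M, hA, valuation_deriv_le hπ hA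
    (fun x => valuation_deriv_le_of_forall_algebraMap P hN) (s := algebraMap A[X] M X) ?_ ?_ ?_⟩
  · simp
  · rw [IsScalarTower.algebraMap_apply A[X] B M]
    exact (P.valuation_lt_one_iff_mem _).2 hXP
  · rw [hq, map_mul, map_mul]
    exact mul_le_of_le_one_right' (hpoly q)

end Place

open Polynomial IntermediateField

/-! ### Extensions of derivations -/

lemma differentialAlgebra_tower_bot (A B M : Type*) [CommRing A] [Field B] [Field M]
    [Differential A] [Differential B] [Differential M] [Algebra A B] [Algebra A M] [Algebra B M]
    [IsScalarTower A B M] [DifferentialAlgebra A M] [DifferentialAlgebra B M] :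
    DifferentialAlgebra A B where
  deriv_algebraMap x := (algebraMap B M).injective <| by
    rw [← deriv_algebraMap, ← IsScalarTower.algebraMap_apply, ← IsScalarTower.algebraMap_apply,
      deriv_algebraMap]

section Stable

variable {F Ω : Type*} [Field F] [Field Ω] [Algebra F Ω] [Differential Ω]

/-- The derivation on an intermediate field that is stable under the derivation. -/
@[reducible]
def differentialOfStable (E : IntermediateField F Ω) (h : ∀ z ∈ E, z′ ∈ E) : Differential E where
  deriv := Derivation.mk'
    (AddMonoidHom.toIntLinearMap
      { toFun := fun z => ⟨(z : Ω)′, h z z.2⟩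
        map_zero' := by ext; simp
        map_add' := fun y z => by ext; simp })
    (fun y z => by ext; simp)

lemma differentialAlgebra_of_stable (E : IntermediateField F Ω) (h : ∀ z ∈ E, z′ ∈ E) :
    letI := differentialOfStable E h
    DifferentialAlgebra E Ω :=
  letI := differentialOfStable E h
  ⟨fun _ => rfl⟩

variable [Differential F] [DifferentialAlgebra F Ω]

lemma deriv_mem_adjoin {S : Set Ω} (hS : ∀ z ∈ S, z′ ∈ adjoin F S) {z : Ω}
    (hz : z ∈ adjoin F S) : z′ ∈ adjoin F S := by
  induction hz using adjoin_induction with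
  | mem z hz => exact hS z hz
  | algebraMap z =>
    rw [deriv_algebraMap]
    exact IntermediateField.algebraMap_mem _ _
  | add y z _ _ hy hz =>
    rw [map_add]
    exact add_mem hy hz
  | inv z hz hz' =>
    rw [Derivation.leibniz_inv]
    exact mul_mem (neg_mem (pow_mem (inv_mem hz) 2)) hz'
  | mul y z hy hz hy' hz' =>
    rw [Derivation.leibniz]
    exact add_mem (mul_mem hy hz') (mul_mem hz hy')

variable [CharZero F]

lemma deriv_mem_adjoin_of_isAlgebraic {z : Ω} (hz : IsAlgebraic F z) : z′ ∈ F⟮z⟯ := by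
  have : FiniteDimensional F F⟮z⟯ := adjoin.finiteDimensional hz.isIntegral
  rw [← AdjoinSimple.algebraMap_gen F z, deriv_algebraMap]
  exact SetLike.coe_mem _

lemma isAlgebraic_deriv {z : Ω} (hz : IsAlgebraic F z) : IsAlgebraic F z′ := by
  have : Algebra.IsAlgebraic F F⟮z⟯ := isAlgebraic_adjoin_simple hz.isIntegral
  simpa using (Algebra.IsAlgebraic.isAlgebraic (R := F)
    (⟨z′, deriv_mem_adjoin_of_isAlgebraic hz⟩ : F⟮z⟯)).algebraMap (A := Ω)

end Stable

section AlgebraicExtension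

variable (F Ω : Type*) [Field F] [Differential F] [Field Ω] [Algebra F Ω]
  [Algebra.IsAlgebraic F Ω]

open TensorProduct KaehlerDifferential in
/-- The extension of a derivation to an algebraic extension. -/
@[reducible]
noncomputable def differentialOfIsAlgebraic [CharZero F] : Differential Ω where
  deriv :=
    have : Algebra.FormallyEtale F Ω := Algebra.FormallyEtale.of_isSeparable F Ω
    (((Derivation.liftKaehlerDifferential
      ((Algebra.linearMap F Ω).compDer (Differential.deriv (R := F)))).liftBaseChange Ω).comp
        (tensorKaehlerEquivOfFormallyEtale ℤ F Ω).symm.toLinearMap).compDer (D ℤ Ω)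

lemma differentialAlgebra_of_isAlgebraic [CharZero F] :
    letI := differentialOfIsAlgebraic F Ω
    DifferentialAlgebra F Ω := by
  let _ := differentialOfIsAlgebraic F Ω
  refine ⟨fun a => ?_⟩
  have : Algebra.FormallyEtale F Ω := Algebra.FormallyEtale.of_isSeparable F Ω
  change LinearMap.liftBaseChange Ω _ ((KaehlerDifferential.tensorKaehlerEquivOfFormallyEtale
    ℤ F Ω).symm (KaehlerDifferential.D ℤ Ω (algebraMap F Ω a))) = _
  rw [KaehlerDifferential.tensorKaehlerEquivOfFormallyEtale_symm_D_algebraMap]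
  simp

variable {F Ω} [Differential Ω] [DifferentialAlgebra F Ω]

lemma mapCoeffs_minpoly_eq_zero {z : Ω} (hz : z′ = 0) :
    Differential.mapCoeffs (minpoly F z) = 0 := by
  have hmonic := minpoly.monic (Algebra.IsIntegral.isIntegral (R := F) z)
  have haeval : aeval z (Differential.mapCoeffs (minpoly F z)) = 0 := by
    simpa [hz] using (Differential.deriv_aeval_eq z (minpoly F z)).symm
  by_contra hne
  refine (minpoly.degree_le_of_ne_zero F z hne haeval).not_gt ?_
  rw [degree_eq_natDegree hmonic.ne_zero, degree_lt_iff_coeff_zero]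
  intro m hm
  rw [Differential.coeff_mapCoeffs]
  obtain hlt | rfl := hm.lt_or_eq
  · rw [coeff_eq_zero_of_natDegree_lt hlt, map_zero]
  · rw [hmonic.coeff_natDegree, Derivation.map_one_eq_zero]

lemma isConstantField_of_isAlgebraic {C : Type*} [Field C] [IsAlgClosed C] [Algebra C F]
    [Algebra C Ω] [IsScalarTower C F Ω] [IsConstantField C F] : IsConstantField C Ω where
  mem_range_of_deriv_eq_zero {z} hz := by
    have hmonic := minpoly.monic (Algebra.IsIntegral.isIntegral (R := F) z)
    have hlifts : minpoly F z ∈ lifts (algebraMap C F) := by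
      refine (lifts_iff_coeff_lifts _).2 fun k => mem_range_of_deriv_eq_zero C ?_
      rw [← Differential.coeff_mapCoeffs, mapCoeffs_minpoly_eq_zero hz, coeff_zero]
    obtain ⟨p, hp, -, hpmonic⟩ := lifts_and_degree_eq_and_monic hlifts hmonic
    have halg : IsIntegral C z :=
      ⟨p, hpmonic, by rw [← aeval_def, ← aeval_map_algebraMap F, hp, minpoly.aeval]⟩
    exact minpoly.mem_range_of_degree_eq_one C z
      (IsAlgClosed.degree_eq_one_of_irreducible C (minpoly.irreducible halg))
  deriv_algebraMap_const c := by
    rw [IsScalarTower.algebraMap_apply C F Ω, deriv_algebraMap,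
      IsConstantField.deriv_algebraMap_const, map_zero]

end AlgebraicExtension

/-! ### Algebraic solutions of the Riccati equation -/

section FractionField

variable {A Ω : Type*} [Field A] [Field Ω] [Algebra A Ω] (s : Ω)

/-- The embedding of `A[X]` in `A⟮s⟯` that sends `X` to `s`. -/
@[reducible]
noncomputable def algebraPolynomialAdjoinSimple : Algebra A[X] A⟮s⟯ :=
  (aeval (AdjoinSimple.gen A s)).toAlgebra

lemma algebraMap_adjoin_simple_eq_aeval (r : A[X]) :
    letI := algebraPolynomialAdjoinSimple (A := A) s
    algebraMap A⟮s⟯ Ω (algebraMap A[X] A⟮s⟯ r) = aeval s r := by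
  rw [← AdjoinSimple.algebraMap_gen A s, aeval_algebraMap_apply]
  rfl

lemma isFractionRing_adjoin_simple {s : Ω} (hs : Transcendental A s) :
    letI := algebraPolynomialAdjoinSimple (A := A) s
    IsFractionRing A[X] A⟮s⟯ := by
  let _ := algebraPolynomialAdjoinSimple (A := A) s
  have haeval := algebraMap_adjoin_simple_eq_aeval (A := A) s
  have : FaithfulSMul A[X] A⟮s⟯ := by
    rw [faithfulSMul_iff_algebraMap_injective]
    refine .of_comp (f := algebraMap A⟮s⟯ Ω) ?_
    simpa only [Function.comp_def, haeval] using transcendental_iff_injective.1 hs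
  refine IsFractionRing.of_field A[X] A⟮s⟯ fun z => ?_
  obtain ⟨r, r', h⟩ := (mem_adjoin_simple_iff A (z : Ω)).1 z.2
  refine ⟨r, r', (algebraMap A⟮s⟯ Ω).injective ?_⟩
  rw [map_div₀, haeval, haeval]
  exact h

end FractionField

section Riccati

variable {A Ω : Type*} [Field A] [IsAlgClosed A] [CharZero A] [Differential A] [Field Ω]
  [Differential Ω] [Algebra A Ω] [DifferentialAlgebra A Ω] {n : ℕ} {a : ℕ → A} {u : Ω}

lemma IsRiccatiSolution.exists_of_isAlgebraic_fractionField {K₀ : Type*} [Field K₀]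
    [Differential K₀] [Algebra A[X] K₀] [IsFractionRing A[X] K₀] [Algebra A K₀]
    [IsScalarTower A A[X] K₀] [Algebra K₀ Ω] [IsScalarTower A K₀ Ω] [DifferentialAlgebra K₀ Ω]
    {q : A[X]} (hq : (algebraMap A[X] K₀ X)′ = algebraMap A[X] K₀ (X * q))
    (hu : IsAlgebraic K₀ u) (hsol : IsRiccatiSolution n (fun i => algebraMap A Ω (a i)) u) :
    ∃ c : A, IsRiccatiSolution n a c := by
  have : CharZero K₀ := charZero_of_injective_algebraMap (IsFractionRing.injective A[X] K₀)
  have : FiniteDimensional K₀ K₀⟮u⟯ := adjoin.finiteDimensional hu.isIntegral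
  let _ : Algebra A[X] K₀⟮u⟯ := ((algebraMap K₀ K₀⟮u⟯).comp (algebraMap A[X] K₀)).toAlgebra
  have : IsScalarTower A[X] K₀ K₀⟮u⟯ := .of_algebraMap_eq' rfl
  have : IsScalarTower A A[X] K₀⟮u⟯ := .of_algebraMap_eq fun x => by
    rw [IsScalarTower.algebraMap_apply A[X] K₀ K₀⟮u⟯, ← IsScalarTower.algebraMap_apply A A[X] K₀,
      ← IsScalarTower.algebraMap_apply A K₀ K₀⟮u⟯]
  have : IsScalarTower A K₀⟮u⟯ Ω := .of_algebraMap_eq fun x => by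
    rw [IsScalarTower.algebraMap_apply A K₀ Ω, IsScalarTower.algebraMap_apply A K₀ K₀⟮u⟯,
      ← IsScalarTower.algebraMap_apply K₀ K₀⟮u⟯ Ω]
  have : DifferentialAlgebra A K₀⟮u⟯ := differentialAlgebra_tower_bot A K₀⟮u⟯ Ω
  obtain ⟨v, hA, hv⟩ := exists_valuation_isCoefficientField A K₀ (M := K₀⟮u⟯) (q := q) <| by
    rw [IsScalarTower.algebraMap_apply A[X] K₀ K₀⟮u⟯, deriv_algebraMap, hq,
      ← IsScalarTower.algebraMap_apply]
  refine exists_residue hv hA (u := AdjoinSimple.gen K₀ u) ?_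
  rw [← isRiccatiSolution_algebraMap_iff (G := Ω), AdjoinSimple.algebraMap_gen]
  simpa only [← IsScalarTower.algebraMap_apply] using hsol

lemma IsRiccatiSolution.exists_of_transcendental {s : Ω} (hs : Transcendental A s) {q : A[X]}
    (hq : s′ = aeval s (X * q)) (hu : IsAlgebraic A⟮s⟯ u)
    (hsol : IsRiccatiSolution n (fun i => algebraMap A Ω (a i)) u) :
    ∃ c : A, IsRiccatiSolution n a c := by
  have hstable (z) (hz : z ∈ A⟮s⟯) : z′ ∈ A⟮s⟯ := by
    refine deriv_mem_adjoin (fun z hz => ?_) hz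
    rw [Set.mem_singleton_iff.1 hz, hq]
    exact algebra_adjoin_le_adjoin A {s} (aeval_mem_adjoin_singleton A s)
  let _ := differentialOfStable _ hstable
  have := differentialAlgebra_of_stable _ hstable
  let _ := algebraPolynomialAdjoinSimple (A := A) s
  have := isFractionRing_adjoin_simple hs
  have : IsScalarTower A A[X] A⟮s⟯ := .of_algebraMap_eq fun x => (aeval_C _ x).symm
  have haeval := algebraMap_adjoin_simple_eq_aeval (A := A) s
  refine hsol.exists_of_isAlgebraic_fractionField (K₀ := A⟮s⟯) (q := q) ?_ hu
  apply (algebraMap A⟮s⟯ Ω).injective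
  rw [← deriv_algebraMap, haeval, haeval, aeval_X, hq]

end Riccati

section Quadrature

/-- `y` is algebraic over `F`, an integral over `F`, or an exponential of integral over `F`. -/
def IsQuadrature (F : Type*) {Ω : Type*} [Field F] [Field Ω] [Differential Ω] [Algebra F Ω]
    (y : Ω) : Prop :=
  IsAlgebraic F y ∨ (∃ b : F, y′ = algebraMap F Ω b) ∨ ∃ b : F, y′ = algebraMap F Ω b * y

variable {A Ω : Type*} [Field A] [Field Ω] [Differential Ω] [Algebra A Ω] {t u : Ω}

lemma IsQuadrature.tower_top {B : Type*} [Field B] [Algebra A B] [Algebra B Ω]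
    [IsScalarTower A B Ω] (ht : IsQuadrature A t) : IsQuadrature B t := by
  obtain halg | ⟨b, hb⟩ | ⟨b, hb⟩ := ht
  · exact .inl (halg.tower_top B)
  · exact .inr (.inl ⟨algebraMap A B b, by rw [hb, IsScalarTower.algebraMap_apply A B Ω]⟩)
  · exact .inr (.inr ⟨algebraMap A B b, by rw [hb, IsScalarTower.algebraMap_apply A B Ω]⟩)

lemma IsQuadrature.algebraMap {Ω' : Type*} [Field Ω'] [Differential Ω'] [Algebra A Ω']
    [Algebra Ω Ω'] [DifferentialAlgebra Ω Ω'] [IsScalarTower A Ω Ω'] (ht : IsQuadrature A t) :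
    IsQuadrature A (algebraMap Ω Ω' t) := by
  obtain halg | ⟨b, hb⟩ | ⟨b, hb⟩ := ht
  · exact .inl halg.algebraMap
  · exact .inr (.inl ⟨b, by
      rw [deriv_algebraMap, hb, IsScalarTower.algebraMap_apply A Ω Ω']⟩)
  · exact .inr (.inr ⟨b, by
      rw [deriv_algebraMap, hb, map_mul, IsScalarTower.algebraMap_apply A Ω Ω']⟩)

omit [Differential Ω] in
lemma adjoin_simple_inv (t : Ω) : A⟮t⁻¹⟯ = A⟮t⟯ := by
  refine le_antisymm ?_ ?_ <;> rw [adjoin_simple_le_iff]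
  · exact inv_mem (mem_adjoin_simple_self A t)
  · simpa using inv_mem (mem_adjoin_simple_self A t⁻¹)

variable [Differential A] [DifferentialAlgebra A Ω] {n : ℕ}

lemma IsQuadrature.deriv_mem_adjoin_simple [CharZero A] (ht : IsQuadrature A t) :
    ∀ z ∈ A⟮t⟯, z′ ∈ A⟮t⟯ := by
  intro z hz
  refine deriv_mem_adjoin ?_ hz
  rintro _ rfl
  obtain halg | ⟨b, hb⟩ | ⟨b, hb⟩ := ht
  · exact deriv_mem_adjoin_of_isAlgebraic halg
  · rw [hb]
    exact IntermediateField.algebraMap_mem _ b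
  · rw [hb]
    exact mul_mem (IntermediateField.algebraMap_mem _ b) (mem_adjoin_simple_self A _)

/-- Expand at `t = ∞`: the parameter `s = t⁻¹` divides `s′` in `A[s]`, unlike `t` in `A[t]`. -/
lemma IsRiccatiSolution.exists_of_isQuadrature [IsAlgClosed A] [CharZero A] {a : ℕ → A}
    (ht : IsQuadrature A t) (hu : IsAlgebraic A⟮t⟯ u)
    (hsol : IsRiccatiSolution n (fun i => algebraMap A Ω (a i)) u) :
    ∃ c : A, IsRiccatiSolution n a c := by
  by_cases halg : IsAlgebraic A t
  · have : Algebra.IsAlgebraic A A⟮t⟯ := isAlgebraic_adjoin_simple halg.isIntegral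
    have hint : IsIntegral A u := (hu.restrictScalars A).isIntegral
    obtain ⟨c, rfl⟩ := minpoly.mem_range_of_degree_eq_one A u
      (IsAlgClosed.degree_eq_one_of_irreducible A (minpoly.irreducible hint))
    exact ⟨c, isRiccatiSolution_algebraMap_iff.1 hsol⟩
  · have ht0 : t ≠ 0 := fun h => halg (h ▸ isAlgebraic_zero)
    have htr : Transcendental A t⁻¹ := fun h => halg (by simpa using h.inv)
    rw [← adjoin_simple_inv] at hu
    obtain ⟨b, hb⟩ | ⟨b, hb⟩ := ht.resolve_left halg
    · refine exists_of_transcendental htr (q := -(C b * X)) ?_ hu hsol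
      simp only [Derivation.leibniz_inv, hb, smul_eq_mul, map_mul, map_neg, aeval_X, aeval_C]
      ring
    · refine exists_of_transcendental htr (q := -C b) ?_ hu hsol
      simp only [Derivation.leibniz_inv, hb, smul_eq_mul, map_mul, map_neg, aeval_X, aeval_C]
      field_simp

lemma IsRiccatiSolution.exists_isAlgebraic_of_isQuadrature {F : Type*} [Field F] [CharZero F]
    [Differential F] [Algebra F Ω] [DifferentialAlgebra F Ω] [IsAlgClosed Ω] {a : ℕ → F}
    (ht : IsQuadrature F t) (hu : IsAlgebraic F⟮t⟯ u)
    (hsol : IsRiccatiSolution n (fun i => algebraMap F Ω (a i)) u) :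
    ∃ c : Ω, IsAlgebraic F c ∧ IsRiccatiSolution n (fun i => algebraMap F Ω (a i)) c := by
  let A := algebraicClosure F Ω
  have hstable (z) (hz : z ∈ A) : z′ ∈ A :=
    mem_algebraicClosure_iff.2 (isAlgebraic_deriv (mem_algebraicClosure_iff.1 hz))
  let _ := differentialOfStable A hstable
  have := differentialAlgebra_of_stable A hstable
  have : IsAlgClosed A := (algebraicClosure.isAlgClosure F Ω).isAlgClosed
  have : CharZero A := charZero_of_injective_algebraMap (algebraMap F A).injective
  have : DifferentialAlgebra F A := differentialAlgebra_tower_bot F A Ω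
  have hle : F⟮t⟯ ≤ A⟮t⟯.restrictScalars F := by
    rw [adjoin_simple_le_iff]
    exact mem_adjoin_simple_self A t
  have huA : IsAlgebraic A⟮t⟯ u := by
    let _ : Algebra F⟮t⟯ A⟮t⟯ := (IntermediateField.inclusion hle).toAlgebra
    have : IsScalarTower F⟮t⟯ A⟮t⟯ Ω := .of_algebraMap_eq' rfl
    exact hu.tower_top _
  obtain ⟨c, hc⟩ := exists_of_isQuadrature (A := A) (a := fun i => algebraMap F A (a i))
    ht.tower_top huA (by simpa only [← IsScalarTower.algebraMap_apply] using hsol)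
  exact ⟨algebraMap A Ω c, mem_algebraicClosure_iff.1 c.2, by
    simpa only [← IsScalarTower.algebraMap_apply] using
      isRiccatiSolution_algebraMap_iff (G := Ω).2 hc⟩

end Quadrature

end FunctionalDiffField

namespace RiemannSurface

open Filter Topology

/-! ### Properties that hold off a closed discrete set -/

section Codiscrete

variable {X : Type*} [TopologicalSpace X] {P : X → Prop}

lemma eventually_codiscrete_iff :
    (∀ᶠ q in codiscrete X, P q) ↔ ∀ p, ∀ᶠ q in 𝓝[≠] p, P q := by
  rw [Filter.Eventually, codiscrete, mem_codiscreteWithin_iff_forall_mem_nhdsNE]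
  simp [Filter.Eventually]

lemma eventually_eventually_nhds_of_codiscrete (h : ∀ᶠ q in codiscrete X, P q) :
    ∀ᶠ q in codiscrete X, ∀ᶠ r in 𝓝 q, P r := by
  filter_upwards [h] with q hq
  exact (mem_codiscrete'.1 h).1.mem_nhds hq

lemma eventually_eventually_nhdsNE [T1Space X] {p : X} (h : ∀ᶠ q in 𝓝[≠] p, P q) :
    ∀ᶠ q in 𝓝[≠] p, ∀ᶠ r in 𝓝 q, P r := by
  filter_upwards [eventually_eventually_nhdsWithin.2 h, self_mem_nhdsWithin] with q hq hqp
  rwa [isOpen_compl_singleton.nhdsWithin_eq hqp] at hq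

lemma eventually_codiscrete_of_dichotomy [T1Space X] [ConnectedSpace X] [∀ p : X, (𝓝[≠] p).NeBot]
    (hP : ∀ p, (∀ᶠ q in 𝓝[≠] p, P q) ∨ ∀ᶠ q in 𝓝[≠] p, ¬P q) {p : X}
    (hp : ∀ᶠ q in 𝓝[≠] p, P q) : ∀ᶠ q in codiscrete X, P q := by
  have near {Q : X → Prop} {p : X} (h : ∀ᶠ q in 𝓝[≠] p, Q q) :
      ∀ᶠ q in 𝓝 p, ∀ᶠ r in 𝓝[≠] q, Q r := by
    rw [← nhdsNE_sup_pure p, eventually_sup, eventually_pure]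
    exact ⟨(eventually_eventually_nhdsNE h).mono fun q hq => nhdsWithin_le_nhds hq, h⟩
  have isClopen : IsClopen {p | ∀ᶠ q in 𝓝[≠] p, P q} := by
    refine ⟨⟨isOpen_iff_mem_nhds.2 fun p hp => ?_⟩, isOpen_iff_mem_nhds.2 fun p hp => near hp⟩
    filter_upwards [near ((hP p).resolve_left hp)] with q hq hq'
    obtain ⟨r, hr, hr'⟩ := (hq.and hq').exists
    exact hr hr'
  have univ_eq := isClopen.eq_univ ⟨p, hp⟩
  exact eventually_codiscrete_iff.2 fun q => Set.eq_univ_iff_forall.1 univ_eq q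

end Codiscrete

/-! ### Derivatives in charts -/

section ChartDeriv

variable {M N : Type*} [TopologicalSpace M] [ChartedSpace ℂ M] [TopologicalSpace N]
  [ChartedSpace ℂ N]

lemma eventually_nhdsNE_iff {P : M → Prop} {p : M} :
    (∀ᶠ q in 𝓝[≠] p, P q) ↔ ∀ᶠ z in 𝓝[≠] (chartAt ℂ p p), P ((chartAt ℂ p).symm z) := by
  rw [← (chartAt ℂ p).eventually_nhdsWithin' P (mem_chart_source ℂ p)]
  suffices h : 𝓝[(chartAt ℂ p).symm ⁻¹' {p}ᶜ] (chartAt ℂ p p) = 𝓝[≠] (chartAt ℂ p p) by rw [h]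
  refine nhdsWithin_eq_nhdsWithin (mem_chart_target ℂ p) (chartAt ℂ p).open_target ?_
  ext z
  refine and_congr_left fun hz => not_congr ⟨fun h : (chartAt ℂ p).symm z = p => ?_, ?_⟩
  · exact ((chartAt ℂ p).right_inv hz).symm.trans (congrArg _ h)
  · rintro rfl
    exact (chartAt ℂ p).left_inv (mem_chart_source ℂ p)

instance neBot_nhdsNE (p : M) : (𝓝[≠] p).NeBot := by
  refine ⟨fun h => ?_⟩
  have : ∀ᶠ _ in 𝓝[≠] p, False := by simp [h]
  simpa using (eventually_nhdsNE_iff.1 this).exists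

instance neBot_codiscrete [Nonempty M] : (codiscrete M).NeBot := by
  refine ⟨fun h => ?_⟩
  have : ∀ᶠ _ in codiscrete M, False := by simp [h]
  simpa using (eventually_codiscrete_iff.1 this (Classical.arbitrary M)).exists

/-- The derivative of `f` at `q` with respect to the preferred coordinate at `q`. -/
noncomputable def chartDeriv (f : M → ℂ) (q : M) : ℂ :=
  deriv (f ∘ (chartAt ℂ q).symm) (chartAt ℂ q q)

lemma chartDeriv_const (c : ℂ) (q : M) : chartDeriv (fun _ => c) q = 0 :=
  deriv_const _ c

lemma chartDeriv_eq_deriv (f : ℂ → ℂ) (z : ℂ) : chartDeriv f z = deriv f z := rfl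

lemma chartDeriv_congr {f g : M → ℂ} {q : M} (h : f =ᶠ[𝓝 q] g) :
    chartDeriv f q = chartDeriv g q := by
  refine Filter.EventuallyEq.deriv_eq ?_
  have := (chartAt ℂ q).tendsto_symm (mem_chart_source ℂ q)
  exact this.eventually h

lemma chartDeriv_eq_mfderiv {f : M → ℂ} {q : M} (hf : MDifferentiableAt 𝓘(ℂ) 𝓘(ℂ) f q) :
    chartDeriv f q = (mfderiv 𝓘(ℂ) 𝓘(ℂ) f q : ℂ →L[ℂ] ℂ) (1 : ℂ) := by
  simp only [mfderiv, hf, mfld_simps, chartAt_self_eq, fderivWithin_univ]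
  rfl

lemma differentiableAt_comp_chart_symm {f : M → ℂ} {q : M}
    (hf : MDifferentiableAt 𝓘(ℂ) 𝓘(ℂ) f q) :
    DifferentiableAt ℂ (f ∘ (chartAt ℂ q).symm) (chartAt ℂ q q) := by
  have h := hf.differentiableWithinAt_writtenInExtChartAt
  simp only [writtenInExtChartAt, mfld_simps, chartAt_self_eq, differentiableWithinAt_univ] at h
  exact h

lemma chartDeriv_add {f g : M → ℂ} {q : M} (hf : MDifferentiableAt 𝓘(ℂ) 𝓘(ℂ) f q)
    (hg : MDifferentiableAt 𝓘(ℂ) 𝓘(ℂ) g q) :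
    chartDeriv (f + g) q = chartDeriv f q + chartDeriv g q :=
  deriv_add (differentiableAt_comp_chart_symm hf) (differentiableAt_comp_chart_symm hg)

lemma chartDeriv_mul {f g : M → ℂ} {q : M} (hf : MDifferentiableAt 𝓘(ℂ) 𝓘(ℂ) f q)
    (hg : MDifferentiableAt 𝓘(ℂ) 𝓘(ℂ) g q) :
    chartDeriv (f * g) q = f q * chartDeriv g q + g q * chartDeriv f q := by
  have h := deriv_mul (differentiableAt_comp_chart_symm hf) (differentiableAt_comp_chart_symm hg)
  simp only [Function.comp_apply, (chartAt ℂ q).left_inv (mem_chart_source ℂ q)] at h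
  exact h.trans ((add_comm _ _).trans (congrArg _ (mul_comm _ _)))

lemma exists_chartDeriv_comp {g : M → N} {v : M} (hg : MDifferentiableAt 𝓘(ℂ) 𝓘(ℂ) g v) :
    ∃ c : ℂ, ∀ f : N → ℂ, MDifferentiableAt 𝓘(ℂ) 𝓘(ℂ) f (g v) →
      chartDeriv (f ∘ g) v = c * chartDeriv f (g v) := by
  refine ⟨(mfderiv 𝓘(ℂ) 𝓘(ℂ) g v : ℂ →L[ℂ] ℂ) (1 : ℂ), fun f hf => ?_⟩
  have map_eq_mul (A : ℂ →L[ℂ] ℂ) (c : ℂ) : A c = c * A 1 := by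
    rw [← smul_eq_mul, ← map_smul, smul_eq_mul, mul_one]
  rw [chartDeriv_eq_mfderiv (hf.comp v hg), chartDeriv_eq_mfderiv hf, mfderiv_comp v hf hg]
  exact map_eq_mul (mfderiv 𝓘(ℂ) 𝓘(ℂ) f (g v)) _

lemma chartDeriv_comp {φ : ℂ → ℂ} {f : M → ℂ} {q : M} (hφ : DifferentiableAt ℂ φ (f q))
    (hf : MDifferentiableAt 𝓘(ℂ) 𝓘(ℂ) f q) :
    chartDeriv (φ ∘ f) q = deriv φ (f q) * chartDeriv f q := by
  obtain ⟨c, hc⟩ := exists_chartDeriv_comp hf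
  have hid := hc id mdifferentiableAt_id
  rw [Function.id_comp, chartDeriv_eq_deriv, deriv_id, mul_one] at hid
  rw [hc φ hφ.mdifferentiableAt, chartDeriv_eq_deriv, hid, mul_comm]

variable [IsManifold 𝓘(ℂ) ω M]

lemma contMDiffAt_iff_analyticAt {f : M → ℂ} {p q : M} (hq : q ∈ (chartAt ℂ p).source) :
    ContMDiffAt 𝓘(ℂ) 𝓘(ℂ) ω f q ↔
      AnalyticAt ℂ (f ∘ (chartAt ℂ p).symm) (chartAt ℂ p q) := by
  rw [contMDiffAt_iff_source_of_mem_source hq]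
  simp only [mfld_simps, contMDiffWithinAt_univ, contMDiffAt_iff_contDiffAt]
  exact ⟨ContDiffAt.analyticAt, AnalyticAt.contDiffAt⟩

lemma exists_deriv_comp_chart_symm {p q : M} (hq : q ∈ (chartAt ℂ p).source) :
    ∃ c : ℂ, c ≠ 0 ∧ ∀ f : M → ℂ, MDifferentiableAt 𝓘(ℂ) 𝓘(ℂ) f q →
      deriv (f ∘ (chartAt ℂ p).symm) (chartAt ℂ p q) = c * chartDeriv f q := by
  have hsymm : MDifferentiableAt 𝓘(ℂ) 𝓘(ℂ) (chartAt ℂ p).symm (chartAt ℂ p q) :=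
    mdifferentiableAt_atlas_symm (chart_mem_atlas ℂ p) ((chartAt ℂ p).map_source hq)
  obtain ⟨c, hc⟩ := exists_chartDeriv_comp hsymm
  rw [(chartAt ℂ p).left_inv hq] at hc
  refine ⟨c, ?_, hc⟩
  rintro rfl
  have hid : chartAt ℂ p ∘ (chartAt ℂ p).symm =ᶠ[𝓝 (chartAt ℂ p q)] id :=
    (chartAt ℂ p).eventually_right_inverse ((chartAt ℂ p).map_source hq)
  have hzero := hc (chartAt ℂ p) (mdifferentiableAt_atlas (chart_mem_atlas ℂ p) hq)
  rw [chartDeriv_congr hid, chartDeriv_eq_deriv, deriv_id, zero_mul] at hzero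
  exact one_ne_zero hzero

lemma eventually_eq_of_chartDeriv_eq_zero {f : M → ℂ} {q : M}
    (hf : ContMDiffAt 𝓘(ℂ) 𝓘(ℂ) ω f q) (h : ∀ᶠ r in 𝓝 q, chartDeriv f r = 0) :
    ∀ᶠ r in 𝓝 q, f r = f q := by
  have hq := mem_chart_source ℂ q
  have hderiv : ∀ᶠ r in 𝓝 q, deriv (f ∘ (chartAt ℂ q).symm) (chartAt ℂ q r) = 0 := by
    filter_upwards [h, (contMDiffAt_iff_contMDiffAt_nhds (by simp)).1 hf,
      chart_source_mem_nhds ℂ q] with r hr hfr hrs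
    obtain ⟨c, -, hc⟩ := exists_deriv_comp_chart_symm hrs
    rw [hc f (hfr.mdifferentiableAt (by simp)), hr, mul_zero]
  obtain ⟨ε, hε, hball⟩ := Metric.eventually_nhds_iff_ball.1
    ((((chartAt ℂ q).eventually_nhds
      (fun z => deriv (f ∘ (chartAt ℂ q).symm) z = 0) hq).2 hderiv).and
      ((contMDiffAt_iff_analyticAt hq).1 hf).eventually_analyticAt)
  filter_upwards [(chartAt ℂ q).continuousAt hq (Metric.ball_mem_nhds _ hε),
    chart_source_mem_nhds ℂ q] with r hr hrs
  have hconst := Metric.isOpen_ball.is_const_of_deriv_eq_zero (convex_ball _ ε).isPreconnected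
    (fun w hw => (hball w hw).2.differentiableAt.differentiableWithinAt)
    (fun w hw => (hball w hw).1) hr (Metric.mem_ball_self hε)
  simpa [(chartAt ℂ q).left_inv hrs] using hconst

end ChartDeriv

/-! ### Meromorphic functions -/

section Meromorphic

variable {U : RiemannSurface.{u}} {x f g : U → ℂ}

namespace IsMeromorphic

lemma const (c : ℂ) : U.IsMeromorphic fun _ => c := fun _ => .const _ _

lemma add (hf : U.IsMeromorphic f) (hg : U.IsMeromorphic g) : U.IsMeromorphic (f + g) :=
  fun p => (hf p).add (hg p)

lemma mul (hf : U.IsMeromorphic f) (hg : U.IsMeromorphic g) : U.IsMeromorphic (f * g) :=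
  fun p => (hf p).mul (hg p)

lemma neg (hf : U.IsMeromorphic f) : U.IsMeromorphic (-f) := fun p => (hf p).neg

lemma inv (hf : U.IsMeromorphic f) : U.IsMeromorphic f⁻¹ := fun p => (hf p).inv

lemma of_contMDiff (hf : ContMDiff 𝓘(ℂ) 𝓘(ℂ) ω f) : U.IsMeromorphic f := fun p =>
  ((contMDiffAt_iff_analyticAt (mem_chart_source ℂ p)).1 (hf p)).meromorphicAt

lemma eventually_contMDiffAt (hf : U.IsMeromorphic f) :
    ∀ᶠ q in codiscrete U, ContMDiffAt 𝓘(ℂ) 𝓘(ℂ) ω f q := by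
  refine eventually_codiscrete_iff.2 fun p => eventually_nhdsNE_iff.2 ?_
  filter_upwards [(hf p).eventually_analyticAt,
    nhdsWithin_le_nhds (chart_target_mem_nhds ℂ p)] with z hz hzt
  rwa [contMDiffAt_iff_analyticAt ((chartAt ℂ p).map_target hzt), (chartAt ℂ p).right_inv hzt]

lemma eventually_mdifferentiableAt (hf : U.IsMeromorphic f) :
    ∀ᶠ q in codiscrete U, MDifferentiableAt 𝓘(ℂ) 𝓘(ℂ) f q :=
  hf.eventually_contMDiffAt.mono fun _ h => h.mdifferentiableAt (by simp)

lemma eventually_eq_or_eventually_ne (hf : U.IsMeromorphic f) (c : ℂ) (p : U) :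
    (∀ᶠ q in 𝓝[≠] p, f q = c) ∨ ∀ᶠ q in 𝓝[≠] p, f q ≠ c := by
  rw [eventually_nhdsNE_iff, eventually_nhdsNE_iff (P := fun q => f q ≠ c)]
  simpa [sub_eq_zero] using
    ((hf p).sub (MeromorphicAt.const c _)).eventually_eq_zero_or_eventually_ne_zero

lemma eventually_eq_const (hf : U.IsMeromorphic f) {c : ℂ} {p : U}
    (hp : ∀ᶠ q in 𝓝[≠] p, f q = c) : ∀ᶠ q in codiscrete U, f q = c :=
  eventually_codiscrete_of_dichotomy (hf.eventually_eq_or_eventually_ne c) hp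

lemma eventually_ne_const (hf : U.IsMeromorphic f) {c : ℂ}
    (hc : ¬∀ᶠ q in codiscrete U, f q = c) : ∀ᶠ q in codiscrete U, f q ≠ c :=
  eventually_codiscrete_iff.2 fun p =>
    (hf.eventually_eq_or_eventually_ne c p).resolve_left fun h => hc (hf.eventually_eq_const h)

end IsMeromorphic

/-- `f` is not constant off a closed discrete set; for meromorphic `f` this is the negation of
being a constant function. -/
def IsNonconstant (f : U → ℂ) : Prop := ¬∃ c, ∀ᶠ q in codiscrete U, f q = c

lemma isNonconstant_iff :
    IsNonconstant f ↔ ¬∃ c : ℂ, (f : U.FunctionClass) = ((fun _ => c : U → ℂ)) := by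
  simp only [IsNonconstant, Germ.coe_eq]
  rfl

lemma IsMeromorphic.eventually_chartDeriv_ne_zero (hf : U.IsMeromorphic f)
    (hne : IsNonconstant f) : ∀ᶠ q in codiscrete U, chartDeriv f q ≠ 0 := by
  refine eventually_codiscrete_iff.2 fun p => ?_
  have hdiff := eventually_codiscrete_iff.1 hf.eventually_contMDiffAt p
  have hsmul : ∀ᶠ z in 𝓝[≠] (chartAt ℂ p p), chartDeriv f ((chartAt ℂ p).symm z) = 0 ↔
      deriv (f ∘ (chartAt ℂ p).symm) z = 0 := by
    filter_upwards [eventually_nhdsNE_iff.1 hdiff,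
      nhdsWithin_le_nhds (chart_target_mem_nhds ℂ p)] with z hz hzt
    obtain ⟨c, hc, hderiv⟩ := exists_deriv_comp_chart_symm ((chartAt ℂ p).map_target hzt)
    rw [← (chartAt ℂ p).right_inv hzt, hderiv f (hz.mdifferentiableAt (by simp))]
    simp [hc, (chartAt ℂ p).right_inv hzt]
  rcases (hf p).deriv.eventually_eq_zero_or_eventually_ne_zero with h | h
  · have hzero : ∀ᶠ q in 𝓝[≠] p, chartDeriv f q = 0 := by
      refine eventually_nhdsNE_iff.2 ?_
      filter_upwards [h, hsmul] with z hz hiff using hiff.2 hz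
    obtain ⟨q, hq, hfq⟩ := ((eventually_eventually_nhdsNE hzero).and hdiff).exists
    have hconst := eventually_eq_of_chartDeriv_eq_zero hfq hq
    exact absurd ⟨f q, hf.eventually_eq_const (nhdsWithin_le_nhds hconst)⟩ hne
  · refine eventually_nhdsNE_iff.2 ?_
    filter_upwards [h, hsmul] with z hz hiff using hiff.not.2 hz

/-! ### The derivation `d / dx` -/

lemma derivWrt_eq_chartDeriv_div (x f : U → ℂ) (q : U) :
    U.derivWrt x f q = chartDeriv f q / chartDeriv x q := rfl

lemma derivWrt_eq_deriv_div {p q : U} (hq : q ∈ (chartAt ℂ p).source)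
    (hx : MDifferentiableAt 𝓘(ℂ) 𝓘(ℂ) x q) (hf : MDifferentiableAt 𝓘(ℂ) 𝓘(ℂ) f q) :
    U.derivWrt x f q = deriv (f ∘ (chartAt ℂ p).symm) (chartAt ℂ p q) /
      deriv (x ∘ (chartAt ℂ p).symm) (chartAt ℂ p q) := by
  obtain ⟨c, hc, hderiv⟩ := exists_deriv_comp_chart_symm hq
  rw [hderiv f hf, hderiv x hx, mul_div_mul_left _ _ hc, derivWrt_eq_chartDeriv_div]

lemma derivWrt_const (x : U → ℂ) (c : ℂ) (q : U) : U.derivWrt x (fun _ => c) q = 0 := by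
  rw [derivWrt_eq_chartDeriv_div, chartDeriv_const, zero_div]

lemma derivWrt_add (x : U → ℂ) {q : U} (hf : MDifferentiableAt 𝓘(ℂ) 𝓘(ℂ) f q)
    (hg : MDifferentiableAt 𝓘(ℂ) 𝓘(ℂ) g q) :
    U.derivWrt x (f + g) q = U.derivWrt x f q + U.derivWrt x g q := by
  simp only [derivWrt_eq_chartDeriv_div, chartDeriv_add hf hg, add_div]

lemma derivWrt_mul (x : U → ℂ) {q : U} (hf : MDifferentiableAt 𝓘(ℂ) 𝓘(ℂ) f q)
    (hg : MDifferentiableAt 𝓘(ℂ) 𝓘(ℂ) g q) :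
    U.derivWrt x (f * g) q = f q * U.derivWrt x g q + g q * U.derivWrt x f q := by
  simp only [derivWrt_eq_chartDeriv_div, chartDeriv_mul hf hg]
  ring

lemma derivWrt_comp (x : U → ℂ) {φ : ℂ → ℂ} {q : U} (hφ : DifferentiableAt ℂ φ (f q))
    (hf : MDifferentiableAt 𝓘(ℂ) 𝓘(ℂ) f q) :
    U.derivWrt x (φ ∘ f) q = deriv φ (f q) * U.derivWrt x f q := by
  simp only [derivWrt_eq_chartDeriv_div, chartDeriv_comp hφ hf, mul_div_assoc]

lemma derivWrt_congr {y : U → ℂ} (hxy : ∀ᶠ q in codiscrete U, x q = y q)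
    (hfg : ∀ᶠ q in codiscrete U, f q = g q) :
    ∀ᶠ q in codiscrete U, U.derivWrt x f q = U.derivWrt y g q := by
  filter_upwards [eventually_eventually_nhds_of_codiscrete hxy,
    eventually_eventually_nhds_of_codiscrete hfg] with q hx hf
  rw [derivWrt_eq_chartDeriv_div, derivWrt_eq_chartDeriv_div, chartDeriv_congr hx,
    chartDeriv_congr hf]

namespace IsMeromorphic

lemma derivWrt (hx : U.IsMeromorphic x) (hf : U.IsMeromorphic f) :
    U.IsMeromorphic (U.derivWrt x f) := by
  refine fun p => ((hf p).deriv.div (hx p).deriv).congr ?_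
  have hdiff := hx.eventually_mdifferentiableAt.and hf.eventually_mdifferentiableAt
  filter_upwards [eventually_nhdsNE_iff.1 (eventually_codiscrete_iff.1 hdiff p),
    nhdsWithin_le_nhds (chart_target_mem_nhds ℂ p)] with z hz hzt
  rw [Function.comp_apply, derivWrt_eq_deriv_div ((chartAt ℂ p).map_target hzt) hz.1 hz.2,
    (chartAt ℂ p).right_inv hzt]
  rfl

lemma eventually_eq_const_of_derivWrt_eq_zero (hx : U.IsMeromorphic x) (hne : IsNonconstant x)
    (hf : U.IsMeromorphic f) (h : ∀ᶠ q in codiscrete U, U.derivWrt x f q = 0) :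
    ∃ c, ∀ᶠ q in codiscrete U, f q = c := by
  by_contra hf'
  obtain ⟨q, hq, hxq, hfq⟩ := (h.and ((hx.eventually_chartDeriv_ne_zero hne).and
    (hf.eventually_chartDeriv_ne_zero hf'))).exists
  exact div_ne_zero hfq hxq hq

end IsMeromorphic

end Meromorphic

/-! ### Analytic maps -/

section Map

variable {U V : RiemannSurface.{u}} {π : V → U} {x f : U → ℂ}

lemma analyticAt_chart_comp (hπ : ContMDiff 𝓘(ℂ) 𝓘(ℂ) ω π) (v : V) :
    AnalyticAt ℂ ((chartAt ℂ (π v) ∘ π) ∘ (chartAt ℂ v).symm) (chartAt ℂ v v) := by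
  have hchart : ContMDiffAt 𝓘(ℂ) 𝓘(ℂ) ω (chartAt ℂ (π v)) (π v) :=
    contMDiffOn_chart.contMDiffAt (chart_source_mem_nhds ℂ (π v))
  exact (contMDiffAt_iff_analyticAt (mem_chart_source ℂ v)).1 (hchart.comp v (hπ v))

lemma eventually_map_eq_or_eventually_map_ne (hπ : ContMDiff 𝓘(ℂ) 𝓘(ℂ) ω π) (p : U) (v : V) :
    (∀ᶠ w in 𝓝[≠] v, π w = p) ∨ ∀ᶠ w in 𝓝[≠] v, π w ≠ p := by
  have hcont := hπ.continuous.continuousAt (x := v)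
  by_cases hv : π v = p
  swap
  · exact .inr (nhdsWithin_le_nhds (hcont.eventually_ne hv))
  subst hv
  have hinj : ∀ᶠ w in 𝓝 v, (chartAt ℂ (π v) (π w) = chartAt ℂ (π v) (π v) ↔ π w = π v) := by
    filter_upwards [hcont (chart_source_mem_nhds ℂ (π v))] with w hw
    exact (chartAt ℂ (π v)).injOn.eq_iff hw (mem_chart_source ℂ (π v))
  have hinj' := eventually_nhdsNE_iff.1 (nhdsWithin_le_nhds hinj)
  rw [eventually_nhdsNE_iff, eventually_nhdsNE_iff (P := fun w => π w ≠ π v)]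
  refine ((analyticAt_chart_comp hπ v).eventually_eq_or_eventually_ne
    (analyticAt_const (v := chartAt ℂ (π v) (π v)))).imp (fun h => ?_) fun h => ?_
  · filter_upwards [nhdsWithin_le_nhds h, hinj'] with z hz hiff using hiff.1 hz
  · filter_upwards [h, hinj'] with z hz hiff using hiff.not.1 hz

lemma tendsto_codiscrete (hπ : ContMDiff 𝓘(ℂ) 𝓘(ℂ) ω π) (hne : ¬∃ p, ∀ v, π v = p) :
    Tendsto π (codiscrete V) (codiscrete U) := by
  have hfibre (p : U) (v : V) : ∀ᶠ w in 𝓝[≠] v, π w ≠ p := by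
    refine (eventually_map_eq_or_eventually_map_ne hπ p v).resolve_left fun h => hne ⟨p, ?_⟩
    have hcod := eventually_codiscrete_of_dichotomy
      (eventually_map_eq_or_eventually_map_ne hπ p) h
    intro w
    by_contra hw
    have hnear := hπ.continuous.continuousAt.eventually_ne hw
    obtain ⟨r, hr, hr'⟩ :=
      ((eventually_codiscrete_iff.1 hcod w).and (nhdsWithin_le_nhds hnear)).exists
    exact hr' hr
  intro S hS
  refine eventually_codiscrete_iff.2 fun v => ?_
  have hmap : Tendsto π (𝓝[≠] v) (𝓝[≠] (π v)) :=
    tendsto_nhdsWithin_iff.2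
      ⟨hπ.continuous.continuousAt.mono_left nhdsWithin_le_nhds, hfibre (π v) v⟩
  exact hmap (eventually_codiscrete_iff.1 hS (π v))

lemma IsMeromorphic.comp_map (hπ : ContMDiff 𝓘(ℂ) 𝓘(ℂ) ω π) (hf : U.IsMeromorphic f) :
    V.IsMeromorphic (f ∘ π) := by
  intro v
  have heq : (f ∘ (chartAt ℂ (π v)).symm) ∘ (chartAt ℂ (π v) ∘ π) ∘ (chartAt ℂ v).symm
      =ᶠ[𝓝 (chartAt ℂ v v)] (f ∘ π) ∘ (chartAt ℂ v).symm := by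
    have hsymm := (chartAt ℂ v).tendsto_symm (mem_chart_source ℂ v)
    filter_upwards [hsymm (hπ.continuous.continuousAt (chart_source_mem_nhds ℂ (π v)))] with z hz
    exact congrArg f ((chartAt ℂ (π v)).left_inv hz)
  refine MeromorphicAt.congr (.comp_analyticAt ?_ (analyticAt_chart_comp hπ v))
    (heq.filter_mono nhdsWithin_le_nhds)
  simpa using hf (π v)

lemma IsNonconstant.comp_map (hπ : ContMDiff 𝓘(ℂ) 𝓘(ℂ) ω π) (hne : ¬∃ p, ∀ v, π v = p)
    (hx : U.IsMeromorphic x) (h : IsNonconstant x) : IsNonconstant (x ∘ π) := by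
  rintro ⟨c, hc⟩
  have hxc := (tendsto_codiscrete hπ hne).eventually
    (hx.eventually_ne_const fun hxc => h ⟨c, hxc⟩)
  obtain ⟨v, hv, hv'⟩ := (hc.and hxc).exists
  exact hv' hv

lemma derivWrt_comp_map (hπ : ContMDiff 𝓘(ℂ) 𝓘(ℂ) ω π) (hne : ¬∃ p, ∀ v, π v = p)
    (hx : U.IsMeromorphic x) (hx' : IsNonconstant x)
    (hf : ∀ᶠ v in codiscrete V, MDifferentiableAt 𝓘(ℂ) 𝓘(ℂ) f (π v)) :
    ∀ᶠ v in codiscrete V, V.derivWrt (x ∘ π) (f ∘ π) v = U.derivWrt x f (π v) := by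
  filter_upwards [(hx.comp_map hπ).eventually_chartDeriv_ne_zero (hx'.comp_map hπ hne hx),
    (tendsto_codiscrete hπ hne).eventually hx.eventually_mdifferentiableAt, hf] with v hv hxv hfv
  obtain ⟨c, hc⟩ := exists_chartDeriv_comp ((hπ v).mdifferentiableAt (by simp))
  rw [hc x hxv] at hv
  rw [derivWrt_eq_chartDeriv_div, hc x hxv, hc f hfv,
    mul_div_mul_left _ _ (left_ne_zero_of_mul hv), derivWrt_eq_chartDeriv_div]

end Map

/-! ### Open subsurfaces -/

section Restrict

variable {U : RiemannSurface.{u}} {x f : U → ℂ}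

/-- A connected open subset of a Riemann surface, as a Riemann surface. -/
noncomputable def restrict (U : RiemannSurface.{u}) (W : TopologicalSpace.Opens U)
    (hW : IsConnected (W : Set U)) : RiemannSurface.{u} where
  carrier := W
  connected := isConnected_iff_connectedSpace.1 hW

variable {W : TopologicalSpace.Opens U} {hW : IsConnected (W : Set U)}

/-- The inclusion of an open subsurface, along which functions are restricted. -/
def inclusion (W : TopologicalSpace.Opens U) (hW : IsConnected (W : Set U)) :
    U.restrict W hW → U := Subtype.val

lemma inclusion_mem (w : U.restrict W hW) : inclusion W hW w ∈ W := w.2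

lemma contMDiff_inclusion : ContMDiff 𝓘(ℂ) 𝓘(ℂ) ω (inclusion W hW) := contMDiff_subtype_val

lemma inclusion_nonconstant : ¬∃ p, ∀ w, inclusion W hW w = p := by
  rintro ⟨p, hp⟩
  obtain ⟨w⟩ : Nonempty (U.restrict W hW) := inferInstance
  obtain ⟨w', hw'⟩ := (neBot_nhdsNE w).nonempty_of_mem self_mem_nhdsWithin
  exact hw' (Subtype.ext ((hp w').trans (hp w).symm))

lemma isMeromorphic_comp_inclusion (h : ∀ q ∈ W, ContMDiffAt 𝓘(ℂ) 𝓘(ℂ) ω f q) :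
    (U.restrict W hW).IsMeromorphic (f ∘ inclusion W hW) :=
  .of_contMDiff fun w => (h _ (inclusion_mem w)).comp w (contMDiff_inclusion w)

lemma exists_isConnected_subset {p : U} {N : Set U} (hN : N ∈ 𝓝 p) :
    ∃ W : TopologicalSpace.Opens U, IsConnected (W : Set U) ∧ (W : Set U) ⊆ N := by
  have : LocallyConnectedSpace U := ChartedSpace.locallyConnectedSpace ℂ U
  obtain ⟨S, ⟨isOpen, -, isConnected⟩, hSN⟩ :=
    (LocallyConnectedSpace.open_connected_basis p).mem_iff.1 hN
  exact ⟨⟨S, isOpen⟩, isConnected, hSN⟩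

lemma IsMeromorphic.exists_log (hf : U.IsMeromorphic f) (hne : ¬∀ᶠ q in codiscrete U, f q = 0) :
    ∃ (W : TopologicalSpace.Opens U) (z : U → ℂ), IsConnected (W : Set U) ∧
      ∀ q ∈ W, ContMDiffAt 𝓘(ℂ) 𝓘(ℂ) ω z q ∧ Complex.exp (z q) = f q := by
  obtain ⟨p, hp, hp0⟩ := (hf.eventually_contMDiffAt.and (hf.eventually_ne_const hne)).exists
  have hslit : ∀ᶠ q in 𝓝 p, f q / f p ∈ Complex.slitPlane := by
    refine (hp.continuousAt.div_const (f p)).eventually (Complex.isOpen_slitPlane.mem_nhds ?_)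
    simp only [div_self hp0, Complex.one_mem_slitPlane]
  obtain ⟨W, hW, hsub⟩ :=
    exists_isConnected_subset (hslit.and ((contMDiffAt_iff_contMDiffAt_nhds (by simp)).1 hp))
  refine ⟨W, fun q => Complex.log (f q / f p) + Complex.log (f p), hW, fun q hq => ⟨?_, ?_⟩⟩
  · have hlog : AnalyticAt ℂ (fun w => Complex.log (w / f p) + Complex.log (f p)) (f q) :=
      (analyticAt_id.div_const.clog (hsub hq).1).add analyticAt_const
    exact hlog.contDiffAt.contMDiffAt.comp q (hsub hq).2
  · rw [Complex.exp_add, Complex.exp_log (Complex.slitPlane_ne_zero (hsub hq).1),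
      Complex.exp_log hp0, div_mul_cancel₀ _ hp0]

lemma exists_eventually_hasDerivAt {g : ℂ → ℂ} {z : ℂ} (hg : AnalyticAt ℂ g z) :
    ∃ G : ℂ → ℂ, ∀ᶠ w in 𝓝 z, HasDerivAt G (g w) w := by
  obtain ⟨ε, hε, hball⟩ := Metric.eventually_nhds_iff_ball.1 hg.eventually_analyticAt
  have hdiff : DifferentiableOn ℂ g (Metric.ball z ε) := fun w hw =>
    (hball w hw).differentiableAt.differentiableWithinAt
  obtain ⟨G, hG⟩ := hdiff.isExactOn_ball
  exact ⟨G, Filter.mem_of_superset (Metric.ball_mem_nhds z hε) hG⟩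

lemma exists_eventually_derivWrt_eq {p : U} (hx : ContMDiffAt 𝓘(ℂ) 𝓘(ℂ) ω x p)
    (hf : ContMDiffAt 𝓘(ℂ) 𝓘(ℂ) ω f p) (hx0 : ∀ᶠ q in 𝓝 p, chartDeriv x q ≠ 0) :
    ∃ F : U → ℂ, ∀ᶠ q in 𝓝 p, ContMDiffAt 𝓘(ℂ) 𝓘(ℂ) ω F q ∧ U.derivWrt x F q = f q := by
  have hp := mem_chart_source ℂ p
  rw [contMDiffAt_iff_analyticAt hp] at hf
  obtain ⟨G, hG⟩ :=
    exists_eventually_hasDerivAt (hf.mul ((contMDiffAt_iff_analyticAt hp).1 hx).deriv)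
  refine ⟨G ∘ chartAt ℂ p, ?_⟩
  filter_upwards [hx0, (contMDiffAt_iff_contMDiffAt_nhds (by simp)).1 hx,
    chart_source_mem_nhds ℂ p,
    (chartAt ℂ p).continuousAt hp (eventually_eventually_nhds.2 hG)] with q hq0 hxq hqs hGq
  have hGan : AnalyticAt ℂ G (chartAt ℂ p q) :=
    Complex.analyticAt_iff_eventually_differentiableAt.2 (hGq.mono fun _ h => h.differentiableAt)
  have hF : ContMDiffAt 𝓘(ℂ) 𝓘(ℂ) ω (G ∘ chartAt ℂ p) q :=
    hGan.contDiffAt.contMDiffAt.comp q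
      (contMDiffOn_chart.contMDiffAt ((chartAt ℂ p).open_source.mem_nhds hqs))
  have hcomp : (G ∘ chartAt ℂ p) ∘ (chartAt ℂ p).symm =ᶠ[𝓝 (chartAt ℂ p q)] G :=
    ((chartAt ℂ p).eventually_right_inverse ((chartAt ℂ p).map_source hqs)).mono
      fun _ h => congrArg G h
  obtain ⟨c, hc, hderiv⟩ := exists_deriv_comp_chart_symm hqs
  have hx0' : deriv (x ∘ (chartAt ℂ p).symm) (chartAt ℂ p q) ≠ 0 := by
    rw [hderiv x (hxq.mdifferentiableAt (by simp))]
    exact mul_ne_zero hc hq0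
  refine ⟨hF, ?_⟩
  rw [derivWrt_eq_deriv_div hqs (hxq.mdifferentiableAt (by simp))
    (hF.mdifferentiableAt (by simp)), hcomp.deriv_eq, hGq.self_of_nhds.deriv, Pi.mul_apply,
    mul_div_cancel_right₀ _ hx0', Function.comp_apply, (chartAt ℂ p).left_inv hqs]

lemma IsMeromorphic.exists_integral (hx : U.IsMeromorphic x) (hne : IsNonconstant x)
    {ι : Type*} [Finite ι] {f : ι → U → ℂ} (hf : ∀ i, U.IsMeromorphic (f i)) :
    ∃ (W : TopologicalSpace.Opens U) (F : ι → U → ℂ), IsConnected (W : Set U) ∧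
      ∀ i, ∀ q ∈ W, ContMDiffAt 𝓘(ℂ) 𝓘(ℂ) ω (F i) q ∧ U.derivWrt x (F i) q = f i q := by
  obtain ⟨p, hxp, hx0, hfp⟩ := (hx.eventually_contMDiffAt.and
    ((eventually_eventually_nhds_of_codiscrete (hx.eventually_chartDeriv_ne_zero hne)).and
      (eventually_all.2 fun i => (hf i).eventually_contMDiffAt))).exists
  choose F hF using fun i => exists_eventually_derivWrt_eq hxp (hfp i) hx0
  obtain ⟨W, hW, hsub⟩ := exists_isConnected_subset (eventually_all.2 hF)
  exact ⟨W, F, hW, fun i q hq => hsub hq i⟩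

end Restrict

/-! ### Fields of meromorphic functions -/

/-- The ring homomorphism of germs induced by composition with a map that tends to the filter. -/
def compTendstoRingHom {α β R : Type*} [CommRing R] {l : Filter α} {m : Filter β} {π : β → α}
    (hπ : Tendsto π m l) : Germ l R →+* Germ m R where
  toFun k := k.compTendsto π hπ
  map_one' := rfl
  map_mul' k l := Germ.inductionOn₂ k l fun _ _ => rfl
  map_zero' := rfl
  map_add' k l := Germ.inductionOn₂ k l fun _ _ => rfl

section MeromorphicFunctions

variable (U : RiemannSurface.{u})

/-- The ring of classes of meromorphic functions on a Riemann surface. -/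
def meromorphicSubring : Subring U.FunctionClass where
  carrier := {k | ∃ f : U → ℂ, U.IsMeromorphic f ∧ k = f}
  mul_mem' := by
    rintro _ _ ⟨f, hf, rfl⟩ ⟨g, hg, rfl⟩
    exact ⟨f * g, hf.mul hg, rfl⟩
  one_mem' := ⟨1, .const 1, rfl⟩
  add_mem' := by
    rintro _ _ ⟨f, hf, rfl⟩ ⟨g, hg, rfl⟩
    exact ⟨f + g, hf.add hg, rfl⟩
  zero_mem' := ⟨0, .const 0, rfl⟩
  neg_mem' := by
    rintro _ ⟨f, hf, rfl⟩
    exact ⟨-f, hf.neg, rfl⟩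

noncomputable instance instFieldMeromorphicSubring : Field (meromorphicSubring U) where
  inv k := ⟨(k : U.FunctionClass)⁻¹, by
    obtain ⟨_, f, hf, rfl⟩ := k
    exact ⟨f⁻¹, hf.inv, rfl⟩⟩
  exists_pair_ne := ⟨0, 1, zero_ne_one⟩
  mul_inv_cancel k hk := by
    obtain ⟨_, f, hf, rfl⟩ := k
    refine Subtype.ext (Germ.coe_eq.2 ?_)
    filter_upwards [hf.eventually_ne_const fun h => hk (Subtype.ext (Germ.coe_eq.2 h))] with q hq
    exact mul_inv_cancel₀ hq
  inv_zero := Subtype.ext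
    (congrArg (fun f : U → ℂ => (f : U.FunctionClass)) (funext fun _ => inv_zero))
  nnqsmul := _
  nnqsmul_def _ _ := rfl
  qsmul := _
  qsmul_def _ _ := rfl

variable {U}

/-- The operator `d / dx` on function classes. -/
noncomputable def classDeriv (x : U → ℂ) : U.FunctionClass → U.FunctionClass :=
  Germ.map' (U.derivWrt x) fun _ _ => derivWrt_congr (.of_forall fun _ => rfl)

lemma classDeriv_add {x f g : U → ℂ} (hf : U.IsMeromorphic f) (hg : U.IsMeromorphic g) :
    classDeriv x ((f : U.FunctionClass) + g) = classDeriv x f + classDeriv x g :=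
  Germ.coe_eq.2 <| by
    filter_upwards [hf.eventually_mdifferentiableAt, hg.eventually_mdifferentiableAt] with q hfq hgq
    exact derivWrt_add x hfq hgq

lemma classDeriv_mul {x f g : U → ℂ} (hf : U.IsMeromorphic f) (hg : U.IsMeromorphic g) :
    classDeriv x ((f : U.FunctionClass) * g) = f * classDeriv x g + g * classDeriv x f :=
  Germ.coe_eq.2 <| by
    filter_upwards [hf.eventually_mdifferentiableAt, hg.eventually_mdifferentiableAt] with q hfq hgq
    exact derivWrt_mul x hfq hgq

/-- The derivation `d / dx` on meromorphic functions. -/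
@[reducible]
noncomputable def differentialMeromorphicSubring {x : U → ℂ} (hx : U.IsMeromorphic x) :
    Differential (meromorphicSubring U) where
  deriv := Derivation.mk'
    (AddMonoidHom.toIntLinearMap (AddMonoidHom.mk'
      (fun k => ⟨classDeriv x k, by
        obtain ⟨_, f, hf, rfl⟩ := k
        exact ⟨_, hx.derivWrt hf, rfl⟩⟩)
      (by
        rintro ⟨_, f, hf, rfl⟩ ⟨_, g, hg, rfl⟩
        exact Subtype.ext (classDeriv_add hf hg))))
    (by
      rintro ⟨_, f, hf, rfl⟩ ⟨_, g, hg, rfl⟩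
      exact Subtype.ext (classDeriv_mul hf hg))

/-- The functional differential field of all meromorphic functions on a Riemann surface. -/
noncomputable def meromorphicField {x : U → ℂ} (hx : U.IsMeromorphic x) (hne : IsNonconstant x) :
    FunctionalDiffField.{u} where
  surface := U
  x := x
  x_meromorphic := hx
  x_nonconstant := isNonconstant_iff.1 hne
  carrier := meromorphicSubring U
  differential := differentialMeromorphicSubring hx
  algebra := RingHom.toAlgebra
    (((Germ.coeRingHom (codiscrete U)).comp (algebraMap ℂ (U → ℂ))).codRestrict
      (meromorphicSubring U) fun c => ⟨fun _ => c, .const c, rfl⟩)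
  toFun := (meromorphicSubring U).subtype
  meromorphic k := k.2
  toFun_const _ := rfl
  toFun_deriv _ _ h := congrArg (classDeriv x) h

end MeromorphicFunctions

end RiemannSurface

namespace FunctionalDiffField

open RiemannSurface Filter

section Basic

variable (K : FunctionalDiffField.{u})

lemma toFun_injective : Function.Injective K.toFun :=
  haveI : Nontrivial K.surface.FunctionClass := inferInstance
  K.toFun.injective

lemma isNonconstant_x : IsNonconstant K.x := isNonconstant_iff.2 K.x_nonconstant

instance instIsConstantField : IsConstantField ℂ K where
  deriv_algebraMap_const c := K.toFun_injective <| by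
    rw [K.toFun_deriv _ _ (K.toFun_const c), map_zero]
    exact congrArg _ (funext fun q => derivWrt_const K.x c q)
  mem_range_of_deriv_eq_zero {k} h := by
    obtain ⟨f, hf, hk⟩ := K.meromorphic k
    have hderiv : ((K.surface.derivWrt K.x f : K.surface → ℂ) : K.surface.FunctionClass) = 0 := by
      rw [← K.toFun_deriv k f hk, h, map_zero]
    obtain ⟨c, hc⟩ := K.x_meromorphic.eventually_eq_const_of_derivWrt_eq_zero K.isNonconstant_x hf
      (Germ.coe_eq.1 hderiv)
    refine ⟨c, K.toFun_injective ?_⟩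
    rw [K.toFun_const, hk]
    exact (Germ.coe_eq.2 hc).symm

instance instCharZero : CharZero K := charZero_of_injective_algebraMap (algebraMap ℂ K).injective

end Basic

/-! ### Extensions of functional differential fields -/

namespace Extension

variable {K : FunctionalDiffField.{u}} (L : Extension K)

lemma toFun_algebraMap {k : K} {f : K.surface → ℂ} (h : K.toFun k = f) :
    L.top.toFun (algebraMap K L.top k) = (f ∘ L.proj : L.top.surface → ℂ) :=
  L.toFun_pullback k f h

instance instDifferentialAlgebra : DifferentialAlgebra K L.top where
  deriv_algebraMap k := L.top.toFun_injective <| by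
    obtain ⟨f, hf, hk⟩ := K.meromorphic k
    rw [L.top.toFun_deriv _ _ (L.toFun_algebraMap hk), L.toFun_algebraMap (K.toFun_deriv k f hk)]
    refine Germ.coe_eq.2 ?_
    filter_upwards [derivWrt_congr (Germ.coe_eq.1 L.x_eq) (.of_forall fun _ => rfl),
      derivWrt_comp_map L.proj_analytic L.proj_nonconstant K.x_meromorphic K.isNonconstant_x
        ((tendsto_codiscrete L.proj_analytic L.proj_nonconstant).eventually
          hf.eventually_mdifferentiableAt)]
      with v hx hf
    exact hx.trans hf

instance instIsScalarTower : IsScalarTower ℂ K L.top := .of_algebraMap_eq fun c =>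
  L.top.toFun_injective <| by
    rw [L.toFun_algebraMap (K.toFun_const c), L.top.toFun_const]
    rfl

section Trans

variable (M : Extension L.top)

lemma x_eq_comp : (M.top.x : M.top.surface.FunctionClass) =
    (K.x ∘ L.proj ∘ M.proj : M.top.surface → ℂ) :=
  M.x_eq.trans (Germ.coe_eq.2
    ((tendsto_codiscrete M.proj_analytic M.proj_nonconstant).eventually (Germ.coe_eq.1 L.x_eq)))

/-- The composition of extensions. -/
noncomputable def trans : Extension K where
  top := M.top
  proj := L.proj ∘ M.proj
  proj_analytic := L.proj_analytic.comp M.proj_analytic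
  proj_nonconstant := fun ⟨p, hp⟩ => M.top.x_nonconstant
    ⟨K.x p, (L.x_eq_comp M).trans (congrArg _ (funext fun v => congrArg K.x (hp v)))⟩
  x_eq := L.x_eq_comp M
  pullback := M.pullback.comp L.pullback
  toFun_pullback k f h := M.toFun_pullback _ _ (L.toFun_pullback k f h)

noncomputable instance instAlgebraTrans : Algebra L.top (L.trans M).top := M.instAlgebraTop

instance instDifferentialAlgebraTrans : DifferentialAlgebra L.top (L.trans M).top :=
  M.instDifferentialAlgebra

instance instIsScalarTowerTrans : IsScalarTower ℂ L.top (L.trans M).top := M.instIsScalarTower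

instance instIsScalarTowerBaseTrans : IsScalarTower K L.top (L.trans M).top :=
  .of_algebraMap_eq fun _ => rfl

end Trans

/-- The field of all meromorphic functions on a surface over that of `K`. -/
noncomputable def ofMap (K : FunctionalDiffField.{u}) {V : RiemannSurface.{u}} {π : V → K.surface}
    (hπ : ContMDiff 𝓘(ℂ) 𝓘(ℂ) ω π) (hne : ¬∃ p, ∀ v, π v = p) : Extension K where
  top := meromorphicField (K.x_meromorphic.comp_map hπ)
    (K.isNonconstant_x.comp_map hπ hne K.x_meromorphic)
  proj := π
  proj_analytic := hπ
  proj_nonconstant := hne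
  x_eq := rfl
  pullback := ((compTendstoRingHom (tendsto_codiscrete hπ hne)).comp K.toFun).codRestrict
    (meromorphicSubring V) fun k => by
      obtain ⟨f, hf, hk⟩ := K.meromorphic k
      exact ⟨f ∘ π, hf.comp_map hπ, congrArg (compTendstoRingHom (tendsto_codiscrete hπ hne)) hk⟩
  toFun_pullback _ _ h := congrArg (compTendstoRingHom (tendsto_codiscrete hπ hne)) h

section Intermediate

variable (E : IntermediateField K L.top) (hE : ∀ z ∈ E, z′ ∈ E)

/-- A differential subfield of an extension, as an extension. -/
noncomputable def sub : Extension K where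
  top :=
    { surface := L.top.surface
      x := L.top.x
      x_meromorphic := L.top.x_meromorphic
      x_nonconstant := L.top.x_nonconstant
      carrier := E
      differential := differentialOfStable E hE
      algebra := ((algebraMap K E).comp (algebraMap ℂ K)).toAlgebra
      toFun := L.top.toFun.comp (algebraMap E L.top)
      meromorphic := fun k => L.top.meromorphic k
      toFun_const := fun c =>
        (congrArg L.top.toFun (IsScalarTower.algebraMap_apply ℂ K L.top c).symm).trans
          (L.top.toFun_const c)
      toFun_deriv := fun k f h => L.top.toFun_deriv k f h }
  proj := L.proj
  proj_analytic := L.proj_analytic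
  proj_nonconstant := L.proj_nonconstant
  x_eq := L.x_eq
  pullback := algebraMap K E
  toFun_pullback k f h := L.toFun_pullback k f h

/-- An extension as an extension of a differential subfield. -/
noncomputable def overSub : Extension (L.sub E hE).top where
  top := L.top
  proj := id
  proj_analytic := contMDiff_id
  proj_nonconstant := fun ⟨p, hp⟩ => L.proj_nonconstant ⟨L.proj p, fun v => congrArg L.proj (hp v)⟩
  x_eq := rfl
  pullback := algebraMap E L.top
  toFun_pullback _ _ h := h

end Intermediate

end Extension

end FunctionalDiffField

namespace FunctionalDiffField

namespace Extension

open IntermediateField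

/-! ### Towers of generalized quadratures -/

section Quadratures

variable {K : FunctionalDiffField.{u}} (L : Extension K)

lemma mem_diffAdjoin_iff {M : Set L.top} {z : L.top} : z ∈ L.diffAdjoin M ↔
    ∀ E : IntermediateField K L.top, (∀ z ∈ E, z′ ∈ E) → M ⊆ E → z ∈ E := by
  rw [diffAdjoin, ← SetLike.mem_coe, coe_sInf]
  simp

lemma subset_diffAdjoin (M : Set L.top) : M ⊆ L.diffAdjoin M := fun _ hz =>
  L.mem_diffAdjoin_iff.2 fun _ _ hM => hM hz

lemma deriv_mem_diffAdjoin (M : Set L.top) : ∀ z ∈ L.diffAdjoin M, z′ ∈ L.diffAdjoin M :=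
  fun z hz => L.mem_diffAdjoin_iff.2 fun E hE hM => hE z (L.mem_diffAdjoin_iff.1 hz E hE hM)

variable {L}

lemma diffAdjoin_le {M : Set L.top} {E : IntermediateField K L.top} (hE : ∀ z ∈ E, z′ ∈ E)
    (hM : M ⊆ E) : L.diffAdjoin M ≤ E := fun _ hz => L.mem_diffAdjoin_iff.1 hz E hE hM

lemma le_diffAdjoin_insert (E : IntermediateField K L.top) (y : L.top) :
    E ≤ L.diffAdjoin (insert y E) :=
  (Set.subset_insert y _).trans (L.subset_diffAdjoin _)

lemma mem_diffAdjoin_insert (E : IntermediateField K L.top) (y : L.top) :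
    y ∈ L.diffAdjoin (insert y E) :=
  L.subset_diffAdjoin _ (Set.mem_insert y _)

namespace QuadratureTower

variable {E F : IntermediateField K L.top}

lemma deriv_mem (hE : L.QuadratureTower E) : ∀ z ∈ E, z′ ∈ E := by
  cases hE with
  | base =>
    intro z hz
    obtain ⟨k, rfl⟩ := mem_bot.1 hz
    rw [deriv_algebraMap]
    exact IntermediateField.algebraMap_mem _ _
  | algebraic | integral | expIntegral => exact L.deriv_mem_diffAdjoin _

lemma adjoin (hE : L.QuadratureTower E) {y : L.top} (hy : IsQuadrature E y) :
    L.QuadratureTower (L.diffAdjoin (insert y E)) := by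
  obtain hy | ⟨b, hb⟩ | ⟨b, hb⟩ := hy
  · exact .algebraic E y hE hy
  · exact .integral E y hE (hb ▸ b.2)
  · exact .expIntegral E y b hE b.2 hb

@[elab_as_elim]
lemma induction_adjoin {motive : ∀ E : IntermediateField K L.top, L.QuadratureTower E → Prop}
    (bot : motive ⊥ .base)
    (adjoin : ∀ E y (hE : L.QuadratureTower E) (hy : IsQuadrature E y),
      motive E hE → motive _ (hE.adjoin hy))
    {E : IntermediateField K L.top} (hE : L.QuadratureTower E) : motive E hE := by
  induction hE with
  | base => exact bot
  | algebraic E y hE hy ih => exact adjoin E y hE (.inl hy) ih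
  | integral E y hE hy ih => exact adjoin E y hE (.inr (.inl ⟨⟨_, hy⟩, rfl⟩)) ih
  | expIntegral E y a hE ha hy ih => exact adjoin E y hE (.inr (.inr ⟨⟨a, ha⟩, hy⟩)) ih

end QuadratureTower

lemma isQuadrature_of_le {E F : IntermediateField K L.top} (hEF : E ≤ F) {y : L.top}
    (hy : IsQuadrature E y) : IsQuadrature F y :=
  letI := (inclusion hEF).toAlgebra
  haveI : IsScalarTower E F L.top := .of_algebraMap_eq fun _ => rfl
  hy.tower_top

lemma QuadratureTower.exists_le {E F : IntermediateField K L.top} (hE : L.QuadratureTower E)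
    (hF : L.QuadratureTower F) : ∃ G, L.QuadratureTower G ∧ E ≤ G ∧ F ≤ G := by
  induction hF using induction_adjoin with
  | bot => exact ⟨E, hE, le_rfl, bot_le⟩
  | adjoin F y _ hy ih =>
    obtain ⟨G, hG, hEG, hFG⟩ := ih
    have hG' := hG.adjoin (isQuadrature_of_le hFG hy)
    exact ⟨_, hG', hEG.trans (le_diffAdjoin_insert G y),
      diffAdjoin_le hG'.deriv_mem (Set.insert_subset (mem_diffAdjoin_insert G y)
        (hFG.trans (le_diffAdjoin_insert G y)))⟩

lemma exists_quadratureTower_of_finset (S : Finset L.top) (hS : ∀ y ∈ S, L.IsRepresentable y) :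
    ∃ E, L.QuadratureTower E ∧ (S : Set L.top) ⊆ E := by
  classical
  induction S using Finset.induction_on with
  | empty => exact ⟨⊥, .base, by simp⟩
  | insert y S _ ih =>
    obtain ⟨E, hE, hSE⟩ := ih fun z hz => hS z (Finset.mem_insert_of_mem hz)
    obtain ⟨F, hF, hyF⟩ := hS y (Finset.mem_insert_self y S)
    obtain ⟨G, hG, hEG, hFG⟩ := hE.exists_le hF
    refine ⟨G, hG, ?_⟩
    rw [Finset.coe_insert]
    exact Set.insert_subset (hFG hyF) (hSE.trans hEG)

variable (L) in
/-- The field of the elements of an extension of `K` that are representable by generalized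
quadratures over `K`. -/
def representableField : IntermediateField K L.top where
  carrier := {y | L.IsRepresentable y}
  mul_mem' := by
    rintro y z ⟨E, hE, hy⟩ ⟨F, hF, hz⟩
    obtain ⟨G, hG, hEG, hFG⟩ := hE.exists_le hF
    exact ⟨G, hG, mul_mem (hEG hy) (hFG hz)⟩
  add_mem' := by
    rintro y z ⟨E, hE, hy⟩ ⟨F, hF, hz⟩
    obtain ⟨G, hG, hEG, hFG⟩ := hE.exists_le hF
    exact ⟨G, hG, add_mem (hEG hy) (hFG hz)⟩
  algebraMap_mem' k := ⟨⊥, .base, IntermediateField.algebraMap_mem _ k⟩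
  inv_mem' := by
    rintro y ⟨E, hE, hy⟩
    exact ⟨E, hE, inv_mem hy⟩

lemma deriv_mem_representableField : ∀ y ∈ L.representableField, y′ ∈ L.representableField := by
  rintro y ⟨E, hE, hy⟩
  exact ⟨E, hE, hE.deriv_mem y hy⟩

lemma exists_quadratureTower_isAlgebraic {y : L.top} (hy : IsAlgebraic L.representableField y) :
    ∃ E, L.QuadratureTower E ∧ IsAlgebraic E y := by
  classical
  obtain ⟨p, hp, hpy⟩ := hy
  let q := p.map (algebraMap L.representableField L.top)
  have hq : q ≠ 0 := (Polynomial.map_ne_zero_iff (RingHom.injective _)).2 hp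
  obtain ⟨E, hE, hqE⟩ := exists_quadratureTower_of_finset q.coeffs fun z hz => by
    obtain ⟨k, -, rfl⟩ := Polynomial.mem_coeffs_iff.1 hz
    rw [Polynomial.coeff_map]
    exact (p.coeff k).2
  have hlift : q ∈ Polynomial.lifts (algebraMap E L.top) :=
    Polynomial.lifts_iff_coeffs_subset_range q |>.2 fun z hz => ⟨⟨z, hqE hz⟩, rfl⟩
  obtain ⟨r, hr⟩ := (Polynomial.mem_lifts q).1 hlift
  refine ⟨E, hE, r, fun h => hq (by rw [← hr, h, Polynomial.map_zero]), ?_⟩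
  rw [← Polynomial.aeval_map_algebraMap L.top, hr, Polynomial.aeval_map_algebraMap, hpy]

lemma mem_representableField_of_isQuadrature {y : L.top}
    (hy : IsQuadrature L.representableField y) : y ∈ L.representableField := by
  obtain ⟨E, hE, hEy⟩ : ∃ E, L.QuadratureTower E ∧ IsQuadrature E y := by
    obtain hy | ⟨⟨b, E, hE, hb⟩, hyb⟩ | ⟨⟨b, E, hE, hb⟩, hyb⟩ := hy
    · exact (exists_quadratureTower_isAlgebraic hy).imp fun E => .imp_right .inl
    · exact ⟨E, hE, .inr (.inl ⟨⟨b, hb⟩, hyb⟩)⟩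
    · exact ⟨E, hE, .inr (.inr ⟨⟨b, hb⟩, hyb⟩)⟩
  exact ⟨_, hE.adjoin hEy, mem_diffAdjoin_insert E y⟩

end Quadratures

section Transfer

variable {K K' : FunctionalDiffField.{u}} {L : Extension K} {L' : Extension K'}
  [Algebra L.top L'.top]

/-- The elements of `L` whose image in `L'` is representable. -/
noncomputable def representableComap
    (hK : ∀ k, L'.IsRepresentable (algebraMap L.top L'.top (algebraMap K L.top k))) :
    IntermediateField K L.top :=
  (L'.representableField.toSubfield.comap (algebraMap L.top L'.top)).toIntermediateField hK

variable [DifferentialAlgebra L.top L'.top]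
  (hK : ∀ k, L'.IsRepresentable (algebraMap L.top L'.top (algebraMap K L.top k)))

include hK in
lemma deriv_mem_representableComap : ∀ z ∈ representableComap hK, z′ ∈ representableComap hK := by
  intro z hz
  change algebraMap L.top L'.top z′ ∈ L'.representableField
  rw [← deriv_algebraMap]
  exact deriv_mem_representableField _ hz

include hK in
lemma IsRepresentable.map {y : L.top} (hy : L.IsRepresentable y) :
    L'.IsRepresentable (algebraMap L.top L'.top y) := by
  suffices h : ∀ E, L.QuadratureTower E → E ≤ representableComap hK by
    obtain ⟨E, hE, hyE⟩ := hy
    exact h E hE hyE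
  intro E hE
  induction hE using QuadratureTower.induction_adjoin with
  | bot => exact bot_le
  | adjoin E y _ hy ih =>
    refine diffAdjoin_le (deriv_mem_representableComap hK) (Set.insert_subset ?_ ih)
    let _ : Algebra E L'.representableField := RingHom.toAlgebra
      (((algebraMap L.top L'.top).comp (algebraMap E L.top)).codRestrict
        L'.representableField.toSubfield fun z => ih z.2)
    have : IsScalarTower E L'.representableField L'.top := .of_algebraMap_eq fun _ => rfl
    exact mem_representableField_of_isQuadrature hy.algebraMap.tower_top

include hK in
lemma isRepresentable_algebraMap_of_diffAdjoin_eq_top {M : Set L.top} (htop : L.diffAdjoin M = ⊤)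
    (hM : ∀ y ∈ M, L'.IsRepresentable (algebraMap L.top L'.top y)) (z : L.top) :
    L'.IsRepresentable (algebraMap L.top L'.top z) :=
  diffAdjoin_le (deriv_mem_representableComap hK) hM (htop ▸ mem_top : z ∈ L.diffAdjoin M)

end Transfer

section Riccati

variable {K : FunctionalDiffField.{u}} {L : Extension K} {Ω : Type*} [Field Ω]
  [Differential Ω] [Algebra L.top Ω] [DifferentialAlgebra L.top Ω]

lemma algebraMap_mem_adjoin_simple {E : IntermediateField K L.top} (hE : ∀ z ∈ E, z′ ∈ E)
    {y : L.top} (hy : IsQuadrature E y) {z : L.top} (hz : z ∈ L.diffAdjoin (insert y E)) :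
    algebraMap L.top Ω z ∈ E⟮algebraMap L.top Ω y⟯ := by
  let _ := differentialOfStable E hE
  have : DifferentialAlgebra E Ω := ⟨fun z => deriv_algebraMap (z : L.top)⟩
  have : CharZero E := charZero_of_injective_algebraMap (algebraMap K E).injective
  let B := E⟮algebraMap L.top Ω y⟯
  have hEB : ∀ z : E, algebraMap L.top Ω z ∈ B := fun z => B.algebraMap_mem z
  let S : IntermediateField K L.top :=
    (B.toSubfield.comap (algebraMap L.top Ω)).toIntermediateField fun k => hEB (algebraMap K E k)
  have hS : ∀ z ∈ S, z′ ∈ S := fun z hz => by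
    change algebraMap L.top Ω z′ ∈ B
    rw [← deriv_algebraMap]
    exact hy.algebraMap.deriv_mem_adjoin_simple _ hz
  exact diffAdjoin_le hS
    (Set.insert_subset (mem_adjoin_simple_self E _) fun z hz => hEB ⟨z, hz⟩) hz

lemma QuadratureTower.exists_isAlgebraic_riccati [IsAlgClosed Ω] [Algebra K Ω]
    [IsScalarTower K L.top Ω] {n : ℕ} {a : ℕ → K} {E : IntermediateField K L.top}
    (hE : L.QuadratureTower E) {u : Ω} (hu : IsAlgebraic E u)
    (hsol : IsRiccatiSolution n (fun i => algebraMap K Ω (a i)) u) :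
    ∃ c : Ω, IsAlgebraic K c ∧ IsRiccatiSolution n (fun i => algebraMap K Ω (a i)) c := by
  induction hE using induction_adjoin generalizing u with
  | bot => exact ⟨u, hu.restrictScalars K, hsol⟩
  | adjoin E y hE hy ih =>
    let _ := differentialOfStable E hE.deriv_mem
    have : DifferentialAlgebra E Ω := ⟨fun z => deriv_algebraMap (z : L.top)⟩
    have : CharZero E := charZero_of_injective_algebraMap (algebraMap K E).injective
    have : IsScalarTower K E Ω := .of_algebraMap_eq fun k =>
      IsScalarTower.algebraMap_apply K L.top Ω k
    let _ : Algebra (L.diffAdjoin (insert y (E : Set L.top))) E⟮algebraMap L.top Ω y⟯ :=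
      RingHom.toAlgebra (((algebraMap L.top Ω).comp (algebraMap _ L.top)).codRestrict
        E⟮algebraMap L.top Ω y⟯.toSubfield
        fun z => algebraMap_mem_adjoin_simple hE.deriv_mem hy z.2)
    have : IsScalarTower (L.diffAdjoin (insert y (E : Set L.top))) E⟮algebraMap L.top Ω y⟯ Ω :=
      .of_algebraMap_eq' rfl
    obtain ⟨c, hc, hcsol⟩ := IsRiccatiSolution.exists_isAlgebraic_of_isQuadrature
      (a := fun i => algebraMap K E (a i)) hy.algebraMap (hu.tower_top E⟮algebraMap L.top Ω y⟯)
      (by simpa only [← IsScalarTower.algebraMap_apply] using hsol)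
    exact ih hc (by simpa only [← IsScalarTower.algebraMap_apply] using hcsol)

end Riccati

/-! ### Integrals and logarithms -/

section Integrals

open RiemannSurface Filter

variable {K : FunctionalDiffField.{u}}

lemma exists_integral {ι : Type*} [Finite ι] (w : ι → K) :
    ∃ (R : Extension K) (I : ι → R.top), ∀ i, (I i)′ = algebraMap K R.top (w i) := by
  choose f hf hw using fun i => K.meromorphic (w i)
  obtain ⟨W, F, hW, hF⟩ := K.x_meromorphic.exists_integral K.isNonconstant_x hf
  have hincl := RiemannSurface.contMDiff_inclusion (hW := hW)
  let R := ofMap K hincl inclusion_nonconstant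
  let I : ι → R.top := fun i => (⟨_, F i ∘ inclusion W hW,
    isMeromorphic_comp_inclusion fun q hq => (hF i q hq).1, rfl⟩ :
      meromorphicSubring (K.surface.restrict W hW))
  refine ⟨R, I, fun i => R.top.toFun_injective ?_⟩
  rw [R.top.toFun_deriv (I i) (F i ∘ inclusion W hW) rfl, R.toFun_algebraMap (hw i)]
  refine Germ.coe_eq.2 ?_
  filter_upwards [derivWrt_comp_map hincl inclusion_nonconstant K.x_meromorphic K.isNonconstant_x
    (.of_forall fun v => (hF i _ (inclusion_mem v)).1.mdifferentiableAt (by simp))] with v hv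
  exact hv.trans (hF i _ (inclusion_mem v)).2

lemma exists_log {y : K} (hy : y ≠ 0) :
    ∃ (R : Extension K) (z : R.top.surface → ℂ), R.top.surface.IsMeromorphic z ∧
      R.top.toFun (algebraMap K R.top y) =
        (fun p => Complex.exp (z p) : R.top.surface → ℂ) := by
  obtain ⟨f, hf, hyf⟩ := K.meromorphic y
  have hne : ¬∀ᶠ q in codiscrete K.surface, f q = 0 := fun h => hy <| K.toFun_injective <| by
    rw [hyf, map_zero]
    exact Germ.coe_eq.2 h
  obtain ⟨W, z, hW, hz⟩ := hf.exists_log hne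
  let R := ofMap K (RiemannSurface.contMDiff_inclusion (hW := hW)) inclusion_nonconstant
  refine ⟨R, z ∘ inclusion W hW, isMeromorphic_comp_inclusion fun q hq => (hz q hq).1, ?_⟩
  rw [R.toFun_algebraMap hyf]
  exact congrArg _ (funext fun v => (hz _ (inclusion_mem v)).2.symm)

end Integrals

end Extension

section Exponentials

open RiemannSurface Filter

variable {K : FunctionalDiffField.{u}} {z : K.surface → ℂ} {y : K}

lemma toFun_deriv_of_toFun_eq_exp (hz : K.surface.IsMeromorphic z)
    (hy : K.toFun y = (fun p => Complex.exp (z p) : K.surface → ℂ)) :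
    K.toFun y′ = ((K.surface.derivWrt K.x z : K.surface → ℂ) : K.surface.FunctionClass) *
      K.toFun y := by
  rw [K.toFun_deriv y _ hy, hy]
  refine Germ.coe_eq.2 ?_
  filter_upwards [hz.eventually_mdifferentiableAt] with q hq
  have hderiv := derivWrt_comp K.x (φ := Complex.exp) Complex.differentiableAt_exp hq
  rwa [Complex.deriv_exp, mul_comm] at hderiv

lemma ne_zero_of_toFun_eq_exp
    (hy : K.toFun y = (fun p => Complex.exp (z p) : K.surface → ℂ)) : y ≠ 0 := by
  rintro rfl
  rw [map_zero] at hy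
  obtain ⟨q, hq⟩ := (Germ.coe_eq.1 hy : ∀ᶠ q in codiscrete K.surface, _).exists
  exact Complex.exp_ne_zero _ hq.symm

namespace Extension.IsExpOfAlgebraicIntegral

variable {L : Extension K} {y : L.top}

lemma ne_zero (h : L.IsExpOfAlgebraicIntegral y) : y ≠ 0 := by
  obtain ⟨z, f, -, hy, -⟩ := h
  exact ne_zero_of_toFun_eq_exp hy

lemma exists_deriv_eq (h : L.IsExpOfAlgebraicIntegral y) :
    ∃ f, IsAlgebraic K f ∧ y′ = f * y := by
  obtain ⟨z, f, hz, hy, hf, halg⟩ := h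
  refine ⟨f, halg, L.top.toFun_injective ?_⟩
  rw [toFun_deriv_of_toFun_eq_exp hz hy, map_mul, hf]

lemma of_toFun_eq_exp {z : L.top.surface → ℂ} (hz : L.top.surface.IsMeromorphic z)
    (hy : L.top.toFun y = (fun p => Complex.exp (z p) : L.top.surface → ℂ))
    (halg : IsAlgebraic K (y′ / y)) : L.IsExpOfAlgebraicIntegral y := by
  have hy0 := ne_zero_of_toFun_eq_exp hy
  have hinv : L.top.toFun y * L.top.toFun y⁻¹ = 1 := by
    rw [← map_mul, mul_inv_cancel₀ hy0, map_one]
  refine ⟨z, y′ / y, hz, hy, ?_, halg⟩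
  rw [div_eq_mul_inv, map_mul, toFun_deriv_of_toFun_eq_exp hz hy, mul_assoc, hinv, mul_one]

end Extension.IsExpOfAlgebraicIntegral

end Exponentials

/-! ### Solvability and reduction of order -/

open IntermediateField

namespace Extension

variable {K : FunctionalDiffField.{u}} {L : Extension K} {n : ℕ} {a : ℕ → K}

section Sub

variable {E : IntermediateField K L.top} (hE : ∀ z ∈ E, z′ ∈ E) {y : L.top}

lemma IsExpOfAlgebraicIntegral.sub (h : L.IsExpOfAlgebraicIntegral y) (hy : y ∈ E) :
    (L.sub E hE).IsExpOfAlgebraicIntegral (⟨y, hy⟩ : E) := by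
  obtain ⟨f, hf, hyf⟩ := h.exists_deriv_eq
  have hlog : y′ / y = f := by rw [hyf, mul_div_cancel_right₀ _ h.ne_zero]
  have halg : IsAlgebraic K (⟨y′ / y, div_mem (hE y hy) hy⟩ : E) :=
    (isAlgebraic_algebraMap_iff (algebraMap E L.top).injective).1 (hlog.symm ▸ hf)
  obtain ⟨z, -, hz, hyz, -⟩ := h
  exact of_toFun_eq_exp (L := L.sub E hE) hz hyz halg

lemma isSolution_sub (hsol : IsSolution n (fun i => algebraMap K L.top (a i)) y) (hy : y ∈ E) :
    IsSolution n (fun i => algebraMap K (L.sub E hE).top (a i)) (⟨y, hy⟩ : E) :=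
  (isSolution_algebraMap_iff (F := (L.sub E hE).top) (G := (L.overSub E hE).top)
    (a := fun i => algebraMap K (L.sub E hE).top (a i)) (y := (⟨y, hy⟩ : E))).1 hsol

lemma IsRepresentable.overSub (hy : L.IsRepresentable y) :
    (L.overSub E hE).IsRepresentable y := by
  let _ : Algebra L.top (L.overSub E hE).top := Algebra.id L.top
  have : DifferentialAlgebra L.top (L.overSub E hE).top := ⟨fun _ => rfl⟩
  exact hy.map (L := L) (L' := L.overSub E hE) fun k =>
    (L.overSub E hE).representableField.algebraMap_mem (algebraMap K E k)

variable (L y) in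
lemma sub_diffAdjoin_eq_top :
    (L.sub (L.diffAdjoin {y}) (L.deriv_mem_diffAdjoin _)).diffAdjoin
      {(⟨y, L.subset_diffAdjoin _ rfl⟩ : L.diffAdjoin {y})} = ⊤ := by
  refine eq_top_iff.2 fun z _ => (mem_diffAdjoin_iff _).2 fun F hF hyF => ?_
  let F' : IntermediateField K (L.diffAdjoin {y}) := F
  have hle : L.diffAdjoin {y} ≤ IntermediateField.lift F' :=
    diffAdjoin_le (by
      rintro _ ⟨z, hz, rfl⟩
      exact ⟨_, hF z hz, rfl⟩) (Set.singleton_subset_iff.2 ⟨_, hyF rfl, rfl⟩)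
  exact (mem_lift (z : L.diffAdjoin {y})).1 (hle (SetLike.coe_mem _))

end Sub

lemma IsExpOfAlgebraicIntegral.isRepresentable {y : L.top} (h : L.IsExpOfAlgebraicIntegral y) :
    L.IsRepresentable y := by
  obtain ⟨f, hf, hyf⟩ := h.exists_deriv_eq
  have hfrep : f ∈ L.representableField :=
    mem_representableField_of_isQuadrature (.inl (hf.tower_top L.representableField))
  exact mem_representableField_of_isQuadrature (.inr (.inr ⟨⟨f, hfrep⟩, hyf⟩))

lemma IsRepresentable.algebraMap_trans {y : L.top} (hy : L.IsRepresentable y)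
    (P : Extension L.top) : (L.trans P).IsRepresentable (algebraMap L.top (L.trans P).top y) :=
  hy.map (L := L) (L' := L.trans P) fun k => (L.trans P).representableField.algebraMap_mem k

lemma IsRepresentable.trans {P : Extension L.top} {w : P.top} (hw : P.IsRepresentable w)
    (hL : ∀ k, (L.trans P).IsRepresentable (algebraMap L.top (L.trans P).top k)) :
    (L.trans P).IsRepresentable w := by
  let _ : Algebra P.top (L.trans P).top := Algebra.id P.top
  have : DifferentialAlgebra P.top (L.trans P).top := ⟨fun _ => rfl⟩
  exact hw.map (L := P) (L' := L.trans P) hL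

end Extension

open Extension

variable {K : FunctionalDiffField.{u}} {n : ℕ} {a : ℕ → K}

lemma IsFundamentalSystem.isRepresentable {L : Extension K} {v : Fin n → L.top}
    (hv : IsFundamentalSystem ℂ n (fun i => algebraMap K L.top (a i)) v)
    (hrep : ∀ j, L.IsRepresentable (v j)) {y : L.top}
    (hy : IsSolution n (fun i => algebraMap K L.top (a i)) y) : L.IsRepresentable y := by
  have hmem : y ∈ Submodule.span ℂ (Set.range v) := by
    rw [hv.span_eq_solutionSpace]
    exact hy
  exact Submodule.span_le (p := (L.representableField.restrictScalars ℂ).toSubmodule).2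
    (Set.range_subset_iff.2 hrep) hmem

lemma IsFundamentalSystem.solvableByQuadratures {L : Extension K} {v : Fin n → L.top}
    (hv : IsFundamentalSystem ℂ n (fun i => algebraMap K L.top (a i)) v)
    (hrep : ∀ j, L.IsRepresentable (v j)) : K.SolvableByQuadratures n a :=
  ⟨L, ⟨v, hv.linearIndependent, hv.isSolution⟩, fun _ => hv.isRepresentable hrep⟩

lemma IsFundamentalSystem.exists_isAlgebraic_logDeriv {L : Extension K}
    {v : Fin (n + 1) → L.top}
    (hv : IsFundamentalSystem ℂ (n + 1) (fun i => algebraMap K L.top (a i)) v)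
    (hrep : L.IsRepresentable (v 0)) :
    ∃ y : L.top, IsSolution (n + 1) (fun i => algebraMap K L.top (a i)) y ∧ y ≠ 0 ∧
      IsAlgebraic K (y′ / y) := by
  let Ω := AlgebraicClosure L.top
  let _ : Differential Ω := differentialOfIsAlgebraic L.top Ω
  have : DifferentialAlgebra L.top Ω := differentialAlgebra_of_isAlgebraic L.top Ω
  have : IsConstantField ℂ Ω := isConstantField_of_isAlgebraic (F := L.top)
  have hv0 : v 0 ≠ 0 := hv.linearIndependent.ne_zero 0
  have hriccati : IsRiccatiSolution (n + 1) (fun i => algebraMap K L.top (a i))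
      ((v 0)′ / v 0) :=
    (isSolution_iff_isRiccatiSolution hv0 (div_mul_cancel₀ _ hv0).symm).1 (hv.isSolution 0)
  obtain ⟨E, hE, hvE⟩ := hrep
  have halg : IsAlgebraic E (algebraMap L.top Ω ((v 0)′ / v 0)) :=
    isAlgebraic_algebraMap (⟨_, div_mem (hE.deriv_mem _ hvE) hvE⟩ : E)
  obtain ⟨c, hc, hcsol⟩ := hE.exists_isAlgebraic_riccati (a := a) halg (by
    simpa only [← IsScalarTower.algebraMap_apply] using
      isRiccatiSolution_algebraMap_iff (G := Ω).2 hriccati)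
  obtain ⟨y, hy, hy0, rfl⟩ := hv.exists_logDeriv_eq (G := Ω) (u := c) (by
    simpa only [← IsScalarTower.algebraMap_apply] using hcsol)
  exact ⟨y, hy, hy0, (isAlgebraic_algebraMap_iff (algebraMap L.top Ω).injective).1 hc⟩

lemma SolvableByQuadratures.exists_isExpOfAlgebraicIntegral
    (h : K.SolvableByQuadratures (n + 1) a) :
    ∃ (N : Extension K) (v : Fin (n + 1) → N.top) (y : N.top),
      IsFundamentalSystem ℂ (n + 1) (fun i => algebraMap K N.top (a i)) v ∧
      (∀ j, N.IsRepresentable (v j)) ∧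
      IsSolution (n + 1) (fun i => algebraMap K N.top (a i)) y ∧
      N.IsExpOfAlgebraicIntegral y := by
  obtain ⟨L, ⟨v, hind, hv⟩, hrep⟩ := h
  have hfund : IsFundamentalSystem ℂ (n + 1) (fun i => algebraMap K L.top (a i)) v := ⟨hind, hv⟩
  obtain ⟨y, hy, hy0, halg⟩ := hfund.exists_isAlgebraic_logDeriv (hrep _ (hv 0))
  obtain ⟨R, z, hz, hyz⟩ := exists_log hy0
  refine ⟨L.trans R, _, algebraMap L.top (L.trans R).top y, hfund.map_algebraMap,
    fun j => (hrep _ (hv j)).algebraMap_trans R, isSolution_algebraMap_iff.2 hy,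
    .of_toFun_eq_exp hz hyz ?_⟩
  rw [deriv_algebraMap, ← map_div₀]
  exact halg.algebraMap

lemma IsFundamentalSystem.solvableByQuadratures_reduced {N : Extension K}
    {v : Fin (n + 1) → N.top}
    (hv : IsFundamentalSystem ℂ (n + 1) (fun i => algebraMap K N.top (a i)) v)
    (hrep : ∀ j, N.IsRepresentable (v j)) {E : IntermediateField K N.top}
    (hE : ∀ z ∈ E, z′ ∈ E) {y : (N.sub E hE).top} (hy0 : y ≠ 0)
    (hy : IsSolution (n + 1) (fun i => algebraMap K (N.sub E hE).top (a i)) y) :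
    (N.sub E hE).top.SolvableByQuadratures n
      (reducedCoeff (n + 1) (fun i => algebraMap K (N.sub E hE).top (a i)) y) := by
  let M := N.overSub E hE
  have hvM : IsFundamentalSystem ℂ (n + 1) (fun i => algebraMap (N.sub E hE).top M.top
      (algebraMap K (N.sub E hE).top (a i))) v := hv
  have hrepM (s : M.top) (hs : IsSolution (n + 1) (fun i => algebraMap (N.sub E hE).top M.top
      (algebraMap K (N.sub E hE).top (a i))) s) : M.IsRepresentable s :=
    (hv.isRepresentable hrep hs).overSub hE
  obtain ⟨w, hw, hws⟩ := hvM.exists_reduced ((map_ne_zero _).2 hy0)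
    (isSolution_algebraMap_iff.2 hy)
  refine IsFundamentalSystem.solvableByQuadratures (L := M) (v := w) ?_ fun j => ?_
  · simpa only [algebraMap_reducedCoeff] using hw
  · obtain ⟨s, hs, hwj⟩ := hws j
    rw [hwj]
    exact deriv_mem_representableField _
      (div_mem (hrepM s hs) (M.representableField.algebraMap_mem y))

lemma SolvableByQuadratures.exists_integrals (h : K.SolvableByQuadratures n a) :
    ∃ (P : Extension K) (I : Fin n → P.top),
      IsFundamentalSystem ℂ n (fun i => algebraMap K P.top (a i)) (fun j => (I j)′) ∧
      ∀ j, P.IsRepresentable (I j) := by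
  obtain ⟨L, ⟨w, hind, hw⟩, hrep⟩ := h
  have hfund : IsFundamentalSystem ℂ n (fun i => algebraMap K L.top (a i)) w := ⟨hind, hw⟩
  obtain ⟨R, I, hI⟩ := exists_integral w
  have hIrep (j) : (L.trans R).IsRepresentable (I j) :=
    mem_representableField_of_isQuadrature
      (.inr (.inl ⟨⟨_, (hrep _ (hw j)).algebraMap_trans R⟩, hI j⟩))
  refine ⟨L.trans R, I, ?_, hIrep⟩
  have hIfund := hfund.map_algebraMap (G := (L.trans R).top)
  exact (funext hI : (fun j => (I j)′) = _) ▸ hIfund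

lemma SolvableByQuadratures.of_reduced {L : Extension K} {y : L.top}
    (htop : L.diffAdjoin {y} = ⊤)
    (hy : IsSolution (n + 1) (fun i => algebraMap K L.top (a i)) y)
    (hexp : L.IsExpOfAlgebraicIntegral y)
    (h : L.top.SolvableByQuadratures n
      (reducedCoeff (n + 1) (fun i => algebraMap K L.top (a i)) y)) :
    K.SolvableByQuadratures (n + 1) a := by
  obtain ⟨P, I, hI, hrep⟩ := h.exists_integrals
  have hL (k : L.top) : (L.trans P).IsRepresentable (algebraMap L.top (L.trans P).top k) := by
    refine isRepresentable_algebraMap_of_diffAdjoin_eq_top (L := L) (L' := L.trans P)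
      (fun k => (L.trans P).representableField.algebraMap_mem k) htop ?_ k
    rintro _ rfl
    exact hexp.isRepresentable.algebraMap_trans P
  have hfund := IsFundamentalSystem.of_reduced (F := P.top)
    (a := fun i => algebraMap L.top P.top (algebraMap K L.top (a i)))
    ((map_ne_zero (algebraMap L.top P.top)).2 hexp.ne_zero) (isSolution_algebraMap_iff.2 hy)
    (by simpa only [algebraMap_reducedCoeff] using hI)
  refine IsFundamentalSystem.solvableByQuadratures (L := L.trans P) hfund
    (Fin.cases (hL y) fun j => ?_)
  exact (L.trans P).representableField.mul_mem (hL y) ((hrep j).trans hL)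

end FunctionalDiffField

theorem theorem35 (K : FunctionalDiffField.{u}) (n : ℕ) (hn : 1 ≤ n) (a : ℕ → K) :
    K.SolvableByQuadratures n a ↔
      ∃ (L : K.Extension) (y₁ : L.top),
        L.diffAdjoin {y₁} = ⊤ ∧
        FunctionalDiffField.IsSolution n (fun i => algebraMap K L.top (a i)) y₁ ∧
        L.IsExpOfAlgebraicIntegral y₁ ∧
        L.top.SolvableByQuadratures (n - 1)
          (FunctionalDiffField.reducedCoeff n (fun i => algebraMap K L.top (a i)) y₁) := by
  obtain ⟨n, rfl⟩ := Nat.exists_eq_add_of_le' hn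
  constructor
  · intro h
    obtain ⟨N, v, y, hv, hrep, hy, hexp⟩ := h.exists_isExpOfAlgebraicIntegral
    have hE := N.deriv_mem_diffAdjoin {y}
    have hyE : y ∈ N.diffAdjoin {y} := N.subset_diffAdjoin _ rfl
    have hexp' := hexp.sub hE hyE
    have hy' := FunctionalDiffField.Extension.isSolution_sub hE hy hyE
    exact ⟨N.sub _ hE, _, N.sub_diffAdjoin_eq_top y, hy', hexp',
      hv.solvableByQuadratures_reduced hrep hE hexp'.ne_zero hy'⟩
  · rintro ⟨L, y, htop, hy, hexp, hred⟩
    exact .of_reduced htop hy hexp hred
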